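/- **Setting.** For $d\ge 0$, inputs are sequences $X=(x_t)_{t\in\mathbb Z}$ in $\mathbb R^d$ with $\|x_t\|_2\le 1$ for all $t$; write $\mathcal X$ for the set of all of them, and $|||\mathbf H|||=\sup_{t\in\mathbb Z}\sup_{X\in\mathcal X}|\mathbf H_t(X)|$. Let $M\ge1$ and let $\rho_1,\dots,\rho_M\in\ell^1(\mathbb N)$ be real kernels; put $(X*\rho_k)(t)=\sum_{s\ge0}\rho_k(s)x_{t-s}$. The target is $$\mathbf H_t(X)=f\big((X*\rho_1)(t),\dots,(X*\rho_M)(t)\big).$$ Here $f:(\mathbb R^d)^M\to\mathbb R$, and on some set $\mathcal D\supseteq\{(v_1,\dots,v_M):\|v_k\|_2\le\|\rho_k\|_{\ell^1}\ \forall k\}$ it is Lipschitz with constant $\|f\|_{\rm Lip}$ (Euclidean norm on $(\mathbb R^d)^M=\mathbb R^{Md}$) and has finite Barron norm $$\|f\|_{\mathcal B}=\inf_\mu\Big\|\,|a|(\|b\|_1+|c|)\,\Big\|_{L^p(\mu)},$$ the infimum being over probability laws $\mu$ of $(a,b,c)\in\mathbb R\times\mathbb R^{Md}\times\mathbb R$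 with $f(v)=\mathbb E_\mu[a\,\sigma(\langle b,v\rangle+c)]$ for all $v\in\mathcal D$. Here $\sigma(z)=\max(z,0)$, and $p\in[1,\infty]$ is arbitrary. **Transformers.** Let $\phi_{\rm lin}(z)=-z$ for $z\ge0$ and $\phi_{\log}(z)=-\log z$ for $z\ge1$, both $-\infty$ otherwise. A one-layer, $H$-head, width-$m$ dot-product-free (DP-free) Transformer with type-RPE, ${\rm type}\in\{{\rm lin},\log\}$, has an arbitrary embedding dimension $D$ and computes $$x^{(0)}_t=W_Ex_t+b_E,\qquad x_t^{(1/2)}=x_t^{(0)}+W_O\sum_{h=1}^H\sum_{s\ge0}\frac{e^{p_h\phi_{\rm type}(s)}}{\sum_{j\ge0}e^{p_h\phi_{\rm type}(j)}}\,W_V^{(h)}x^{(0)}_{t-s},$$ $$\mathbf{TF}_t(X)=\sum_{k=1}^m a_k\,\sigma\big(\langle b_k,x_t^{(1/2)}\rangle+c_k\big).$$ Here $W_E\in\mathbb R^{D\times d}$, $b_E\in\mathbb R^D$, $W_V^{(h)},W_O\in\mathbb R^{D\times D}$, $b_k\in\mathbb R^D$, $a_k,c_k\in\mathbb R$, and $p_h>0$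 is such that the normalising series converges. **Theorem (Approximation rates, essentially sparse memories).** There are an absolute constant $C_0>0$ and constants $C(n)>0$ depending only on $n$ such that the following holds for all $d,M,\rho_1,\dots,\rho_M,\mathcal D,f,p$ as above and all $R\ge1$ with $\|\rho_k\|_{\ell^1}\le R$ for every $k$. Put $$\mathcal E_{\rm FFN}=C_0\,R\,\|f\|_{\mathcal B}\sqrt{\frac{M\log(m+1)}{m}},\qquad \mathcal E_{\rm Attn}=\frac{C(n)\,K\,M^{n+1}}{H^n}.$$ (A) Let $\beta>0$ and suppose $|\rho_k(t)|\le Ke^{-\beta t}$ for all $k$ and all $t\ge0$. Then for all integers $1\le n\le\lfloor99\beta\rfloor$ and $H,m\ge1$ there is a one-layer, $H$-head, width-$m$ DP-free Transformer $\mathbf{TF}$ with lin-RPE such that $$|||\mathbf H-\mathbf{TF}|||\le\mathcal E_{\rm FFN}+\|f\|_{\rm Lip}\,\mathcal E_{\rm Attn}.$$ (B) Let $\beta>1$ and suppose $|\rho_k(t)|\le Kt^{-\beta}$ for all $k$ and all $t\ge1$. Then for all integers $1\le n\le\lfloor0.99\beta\rfloor-1$ and $H,m\ge1$ there is a one-layer,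 $H$-head, width-$m$ DP-free Transformer $\mathbf{TF}$ with log-RPE satisfying the same bound. -/

import Mathlib

open MeasureTheory
open scoped ENNReal NNReal

noncomputable section

/-- Euclidean space `ℝᵈ`. -/
abbrev Euc (d : ℕ) : Type := EuclideanSpace ℝ (Fin d)

/-- Bi-infinite sequences `X = (x_t)_{t ∈ ℤ}` of tokens in `ℝᵈ`. -/
abbrev TokenSeq (d : ℕ) : Type := ℤ → Euc d

/-- The admissible inputs: all sequences with `‖x_t‖₂ ≤ 1` for every `t`. -/
def admissibleInputs (d : ℕ) : Set (TokenSeq d) := {X | ∀ t, ‖X t‖ ≤ 1}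

/-- The norm `sup_t sup_{X ∈ 𝒳} |H_t(X)|` of a sequence-to-sequence map with scalar outputs,
as an extended nonnegative number. -/
def seqNorm {d : ℕ} (𝒳 : Set (TokenSeq d)) (H : TokenSeq d → ℤ → ℝ) : ℝ≥0∞ :=
  ⨆ t : ℤ, ⨆ X ∈ 𝒳, ‖H X t‖ₑ

/-- The ReLU activation. -/
def reluFn (x : ℝ) : ℝ := max x 0

/-! ### Barron functions -/

/-- `μ` is a probability law of `(a, b, c)` with `f(x) = 𝔼[a σ(⟨b, x⟩ + c)]` for all `x ∈ X`. -/
def IsBarronRep {ι : Type} [Fintype ι] (X : Set (EuclideanSpace ℝ ι))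
    (f : EuclideanSpace ℝ ι → ℝ) (μ : Measure (ℝ × EuclideanSpace ℝ ι × ℝ)) : Prop :=
  IsProbabilityMeasure μ ∧ ∀ x ∈ X,
    Integrable (fun θ : ℝ × EuclideanSpace ℝ ι × ℝ =>
      θ.1 * reluFn (inner ℝ θ.2.1 x + θ.2.2)) μ ∧
    f x = ∫ θ, θ.1 * reluFn (inner ℝ θ.2.1 x + θ.2.2) ∂μ

/-- The Barron norm of `f` on the domain `X`: the infimum over all representing laws of the
`L^p` norm of `|a| (‖b‖₁ + |c|)`. It is `⊤` if `f` has no representation of finite norm. -/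
def barronNorm {ι : Type} [Fintype ι] (p : ℝ≥0∞) (X : Set (EuclideanSpace ℝ ι))
    (f : EuclideanSpace ℝ ι → ℝ) : ℝ≥0∞ :=
  ⨅ (μ : Measure (ℝ × EuclideanSpace ℝ ι × ℝ)) (_ : IsBarronRep X f μ),
    eLpNorm (fun θ : ℝ × EuclideanSpace ℝ ι × ℝ =>
      |θ.1| * ((∑ i, |θ.2.1 i|) + |θ.2.2|)) p μ

/-! ### Essentially sparse memories -/

/-- The space `ℓ¹(ℕ)` of real memory kernels. -/
abbrev MemoryKernel : Type := lp (fun _ : ℕ => ℝ) 1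

/-- The convolution `(X * ρ)(t) = ∑_{s ≥ 0} ρ(s) x_{t-s}`. -/
def seqConv {d : ℕ} (X : TokenSeq d) (ρ : MemoryKernel) (t : ℤ) : Euc d :=
  ∑' s : ℕ, ρ s • X (t - s)

/-- The concatenated vector `((X * ρ₁)(t), …, (X * ρ_M)(t))` in `(ℝᵈ)ᴹ = ℝᴹᵈ`,
with its Euclidean norm. -/
def memoryVector {d M : ℕ} (ρ : Fin M → MemoryKernel) (X : TokenSeq d) (t : ℤ) :
    EuclideanSpace ℝ (Fin M × Fin d) :=
  WithLp.toLp 2 (fun q => seqConv X (ρ q.1) t q.2)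

/-- The target `H_t(X) = f((X * ρ₁)(t), …, (X * ρ_M)(t))`. -/
def essTarget {d M : ℕ} (f : EuclideanSpace ℝ (Fin M × Fin d) → ℝ) (ρ : Fin M → MemoryKernel)
    (X : TokenSeq d) (t : ℤ) : ℝ :=
  f (memoryVector ρ X t)

/-- The natural domain of `f`: all `(v₁, …, v_M)` in `(ℝᵈ)ᴹ` with `‖v_k‖₂ ≤ ‖ρ_k‖_{ℓ¹}`. -/
def memoryDomain {M : ℕ} (d : ℕ) (ρ : Fin M → MemoryKernel) :
    Set (EuclideanSpace ℝ (Fin M × Fin d)) :=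
  {v | ∀ k, ‖(WithLp.toLp 2 (fun i => v (k, i)) : Euc d)‖ ≤ ‖ρ k‖}

/-! ### One-layer Transformers with relative positional encoding -/

/-- The two types of relative positional encoding. -/
inductive RPEType : Type
  | lin : RPEType
  | log : RPEType

/-- `φ_lin(z) = -z` for `z ≥ 0`, `φ_log(z) = -log z` for `z ≥ 1`, and `-∞` otherwise. -/
def rpePhi : RPEType → ℤ → EReal
  | RPEType.lin, z => if 0 ≤ z then ((-(z : ℝ) : ℝ) : EReal) else ⊥
  | RPEType.log, z => if 1 ≤ z then ((-Real.log (z : ℝ) : ℝ) : EReal) else ⊥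

/-- Parameters of a one-layer Transformer with token dimension `d`, embedding dimension `D`,
`H` attention heads, a two-layer ReLU network of width `m` as readout, and scalar output. -/
structure OneLayerTransformer (d D H m : ℕ) where
  /-- embedding matrix -/
  WE : Euc d →L[ℝ] Euc D
  /-- embedding bias -/
  bE : Euc D
  /-- query matrices -/
  WQ : Fin H → (Euc D →L[ℝ] Euc D)
  /-- key matrices -/
  WK : Fin H → (Euc D →L[ℝ] Euc D)
  /-- value matrices -/
  WV : Fin H → (Euc D →L[ℝ] Euc D)
  /-- output matrix -/
  WO : Euc D →L[ℝ] Euc D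
  /-- positive coefficients of the relative positional encodings -/
  p : Fin H → ℝ
  p_pos : ∀ h, 0 < p h
  /-- outer weights of the readout network -/
  a : Fin m → ℝ
  /-- inner weights of the readout network -/
  b : Fin m → Euc D
  /-- biases of the readout network -/
  c : Fin m → ℝ

namespace OneLayerTransformer

variable {d D H m : ℕ}

/-- The embedded tokens `x_t^{(0)} = W_E x_t + b_E`. -/
def embed (T : OneLayerTransformer d D H m) (X : TokenSeq d) (t : ℤ) : Euc D :=
  T.WE (X t) + T.bE

/-- The unnormalised softmax weight `exp(⟨W_Q x_t, W_K x_{t-s}⟩ + p φ(s))` of head `h`,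
where `exp(-∞) = 0`. -/
def weight (T : OneLayerTransformer d D H m) (ty : RPEType) (X : TokenSeq d) (t : ℤ)
    (h : Fin H) (s : ℕ) : ℝ :=
  (EReal.exp
    (((inner ℝ (T.WQ h (T.embed X t)) (T.WK h (T.embed X (t - s))) : ℝ) : EReal)
      + (T.p h : EReal) * rpePhi ty (s : ℤ))).toReal

/-- The multi-head attention block at time `t`. -/
def attn (T : OneLayerTransformer d D H m) (ty : RPEType) (X : TokenSeq d) (t : ℤ) : Euc D :=
  T.WO (∑ h, ∑' s : ℕ,
    (T.weight ty X t h s / ∑' j : ℕ, T.weight ty X t h j) • T.WV h (T.embed X (t - s)))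

/-- The tokens `x_t^{(1/2)} = x_t^{(0)} + Attn_t(X^{(0)})` after the residual attention block. -/
def hidden (T : OneLayerTransformer d D H m) (ty : RPEType) (X : TokenSeq d) (t : ℤ) : Euc D :=
  T.embed X t + T.attn ty X t

/-- The output `FFN(x_t^{(1/2)}) = ∑_k a_k σ(⟨b_k, x_t^{(1/2)}⟩ + c_k)`
(no residual in the readout). -/
def output (T : OneLayerTransformer d D H m) (ty : RPEType) (X : TokenSeq d) (t : ℤ) : ℝ :=
  ∑ k, T.a k * reluFn (inner ℝ (T.b k) (T.hidden ty X t) + T.c k)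

/-- All query and key matrices vanish. -/
def DotProductFree (T : OneLayerTransformer d D H m) : Prop :=
  (∀ h, T.WQ h = 0) ∧ (∀ h, T.WK h = 0)

/-- All softmax denominators are convergent series, on all admissible inputs. -/
def SoftmaxConverges (T : OneLayerTransformer d D H m) (ty : RPEType) : Prop :=
  ∀ X ∈ admissibleInputs d, ∀ (t : ℤ) (h : Fin H), Summable (T.weight ty X t h)

end OneLayerTransformer

/-- The class of maps realised by one-layer, `H`-head, width-`m` dot-product-free Transformers
with the given type of relative positional encoding; the embedding dimension is free. -/
def DPFTransformers (d H m : ℕ) (ty : RPEType) : Set (TokenSeq d → ℤ → ℝ) :=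
  {F | ∃ (D : ℕ) (T : OneLayerTransformer d D H m),
    T.DotProductFree ∧ T.SoftmaxConverges ty ∧ F = T.output ty}

/-- The claimed error bound `E_FFN + ‖f‖_Lip E_Attn`, with
`E_FFN = C₀ R ‖f‖_B √(M log(m+1) / m)` and `E_Attn = Cₙ K M^(n+1) / H^n`. -/
def errorBound (C₀ Cₙ R K B L : ℝ) (M n H m : ℕ) : ℝ :=
  C₀ * R * B * Real.sqrt (M * Real.log (m + 1) / m)
    + L * (Cₙ * K * (M : ℝ) ^ (n + 1) / (H : ℝ) ^ n)

end

/-! The error splits in two: the kernels `ρ k` are replaced by kernels `κ k` that attention heads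
produce exactly, and `f` is replaced by a network of width `m`. The Lipschitz constant transfers the
first error. The second is uniform over vectors obeying the norm bounds of the memory domain. For
the split to make sense the vectors built from `κ` must still lie in `𝒟`, hence the requirement `‖κ
k‖ ≤ ‖ρ k‖`.

Network. By homogeneity of the ReLU and Hahn–Banach, `f` divided by a bound on its Barron norm
extends to an element of the closed convex hull of unit neurons over a ball of radius `r`
(`inv_smul_integral_mem_closure_convexHull`). Drawing `m` neurons from a convex combination gives
uniform error of order `r / √m`, without dimension dependence. The argument is symmetrization
followed by contraction: for convex functionals of supremum type, each centred draw is dominated by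
a randomly signed draw of the linear function under the ReLU, and signed sums of vectors in a
Hilbert space have norm of order `√m` by the parallelogram law. Everything is phrased with finite
averages and iterated operators on functionals.

Kernels. Heads with exponents `c, 2c, …, Hc` have kernels `u, u², …, u^H`, where `u` is a single
decreasing sequence. If `u` decreases at least threefold at each of the first `H` nodes, Lagrange
interpolation in the variable `u` reproduces the target at these nodes, and the basis polynomials
are so small past the last node that the remaining error is at most five times the decay bound
(`exists_lacunary_approximation`). The `ℓ¹` error is thus a tail sum, of order `H ^ (-n)` in both
decay regimes. The exponents depend only on `n` and `H`, so the same heads serve all `M` kernels;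
only the value matrices see `k`.

Realization. The embedding space holds the current token and the `M` memories side by side. Value
matrices undo the softmax normalization, and the readout adds the multiple of the current token
supplied by the residual connection. -/

/-! ### Functionals with the contraction property -/

/-- Convex functionals on `C(Ω, ℝ)` which, averaged over a random sign, do not decrease when the
increment is replaced by one with larger oscillations. -/
structure IsContractive {Ω : Type*} [TopologicalSpace Ω] (P : C(Ω, ℝ) → ℝ) : Prop where
  convexOn : ConvexOn ℝ Set.univ P
  contract : ∀ Ψ φ t : C(Ω, ℝ), (∀ u v, |φ u - φ v| ≤ |t u - t v|) →
    P (Ψ + φ) + P (Ψ - φ) ≤ P (Ψ + t) + P (Ψ - t)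

/-! ### Random sampling of neurons in the uniform norm: symmetrization and contraction. -/

section Sampling

variable {Ω : Type*} [TopologicalSpace Ω]

theorem IsContractive.add {P Q : C(Ω, ℝ) → ℝ} (hP : IsContractive P) (hQ : IsContractive Q) :
    IsContractive fun Ψ => P Ψ + Q Ψ where
  convexOn := hP.convexOn.add hQ.convexOn
  contract Ψ φ t h := by
    have h₁ := hP.contract Ψ φ t h
    have h₂ := hQ.contract Ψ φ t h
    linarith

theorem IsContractive.smul {P : C(Ω, ℝ) → ℝ} (hP : IsContractive P) {c : ℝ} (hc : 0 ≤ c) :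
    IsContractive fun Ψ => c * P Ψ where
  convexOn := hP.convexOn.smul hc
  contract Ψ φ t h := by
    have h₁ := mul_le_mul_of_nonneg_left (hP.contract Ψ φ t h) hc
    linarith

theorem IsContractive.sum {ι : Type*} (s : Finset ι) {P : ι → C(Ω, ℝ) → ℝ}
    (hP : ∀ i, IsContractive (P i)) : IsContractive fun Ψ => ∑ i ∈ s, P i Ψ := by
  classical
  induction s using Finset.induction_on with
  | empty =>
    simp only [Finset.sum_empty]
    exact ⟨convexOn_const _ convex_univ, fun _ _ _ _ => by simp⟩
  | insert i s hi ih =>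
    simp only [Finset.sum_insert hi]
    exact (hP i).add ih

theorem IsContractive.translate {P : C(Ω, ℝ) → ℝ} (hP : IsContractive P) (A : C(Ω, ℝ)) :
    IsContractive fun Ψ => P (Ψ + A) where
  convexOn := by
    refine ⟨convex_univ, fun x _ y _ a b ha hb hab => ?_⟩
    have h := hP.convexOn.2 (Set.mem_univ (x + A)) (Set.mem_univ (y + A)) ha hb hab
    have e : a • (x + A) + b • (y + A) = a • x + b • y + A := by
      rw [smul_add, smul_add, add_add_add_comm, ← add_smul, hab, one_smul]
    rwa [e] at h
  contract Ψ φ t h := by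
    have h₁ := hP.contract (Ψ + A) φ t h
    simpa only [add_right_comm, sub_add_eq_add_sub] using h₁

theorem IsContractive.comp_neg {P : C(Ω, ℝ) → ℝ} (hP : IsContractive P) :
    IsContractive fun Ψ => P (-Ψ) where
  convexOn := by
    refine ⟨convex_univ, fun x _ y _ a b ha hb hab => ?_⟩
    have h := hP.convexOn.2 (Set.mem_univ (-x)) (Set.mem_univ (-y)) ha hb hab
    rwa [smul_neg, smul_neg, ← neg_add] at h
  contract Ψ φ t h := by
    have h₁ := hP.contract (-Ψ) φ t h
    simp only [neg_add, neg_sub', sub_neg_eq_add, ← sub_eq_add_neg] at h₁ ⊢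
    linarith

theorem ContinuousMap.apply_le_iSup [CompactSpace Ω] (Ψ : C(Ω, ℝ)) (u : Ω) :
    Ψ u ≤ ⨆ u, Ψ u :=
  le_ciSup (isCompact_range Ψ.continuous).bddAbove u

/-- The sum of the two suprema is a supremum over pairs of `Ψ u + Ψ v + φ u - φ v`. The last
difference is at most `|t u - t v|`, and its sign decides which of `u`, `v` is used with `+t` and
which with `-t`. -/
theorem isContractive_iSup [CompactSpace Ω] [Nonempty Ω] :
    IsContractive fun Ψ : C(Ω, ℝ) => ⨆ u, Ψ u where
  convexOn := by
    refine ⟨convex_univ, fun x _ y _ a b ha hb hab => ciSup_le fun u => ?_⟩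
    simp only [ContinuousMap.add_apply, ContinuousMap.smul_apply, smul_eq_mul]
    exact add_le_add (mul_le_mul_of_nonneg_left (x.apply_le_iSup u) ha)
      (mul_le_mul_of_nonneg_left (y.apply_le_iSup u) hb)
  contract Ψ φ t h := by
    rw [← le_sub_iff_add_le]
    refine ciSup_le fun u => ?_
    rw [le_sub_iff_add_le, add_comm, ← le_sub_iff_add_le]
    refine ciSup_le fun v => ?_
    have h₁ := (Ψ + t).apply_le_iSup u
    have h₂ := (Ψ + t).apply_le_iSup v
    have h₃ := (Ψ - t).apply_le_iSup u
    have h₄ := (Ψ - t).apply_le_iSup v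
    have h₅ := (le_abs_self _).trans (h u v)
    simp only [ContinuousMap.add_apply, ContinuousMap.sub_apply] at *
    rcases abs_cases (t u - t v) with ⟨h₆, _⟩ | ⟨h₆, _⟩ <;> linarith

/-- The averages of `P` over one centred random draw from the dictionary `g`. -/
noncomputable def drawAverage {ι : Type*} [Fintype ι] (c : ι → ℝ) (g : ι → C(Ω, ℝ)) (P : C(Ω, ℝ) → ℝ)
    (Ψ : C(Ω, ℝ)) : ℝ :=
  ∑ j, c j * P (Ψ + (g j - ∑ i, c i • g i))

/-- The averages of `P` over one randomly signed draw from the dictionary `2 • t`. -/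
noncomputable def signedAverage {ι : Type*} [Fintype ι] (c : ι → ℝ) (t : ι → C(Ω, ℝ)) (P : C(Ω, ℝ) → ℝ)
    (Ψ : C(Ω, ℝ)) : ℝ :=
  ∑ j, c j * (2⁻¹ * (P (Ψ + (2 : ℝ) • t j) + P (Ψ - (2 : ℝ) • t j)))

variable {ι : Type*} [Fintype ι] {c : ι → ℝ} {g t : ι → C(Ω, ℝ)} {P Q : C(Ω, ℝ) → ℝ}

theorem IsContractive.signedAverage (hc : ∀ j, 0 ≤ c j) (hP : IsContractive P) :
    IsContractive (signedAverage c t P) := by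
  refine IsContractive.sum _ fun j => IsContractive.smul ?_ (hc j)
  refine IsContractive.smul ?_ (by norm_num)
  simp only [sub_eq_add_neg]
  exact (hP.translate _).add (hP.translate _)

theorem drawAverage_mono (hc : ∀ j, 0 ≤ c j) (h : ∀ Ψ, P Ψ ≤ Q Ψ) (Ψ : C(Ω, ℝ)) :
    drawAverage c g P Ψ ≤ drawAverage c g Q Ψ :=
  Finset.sum_le_sum fun j _ => mul_le_mul_of_nonneg_left (h _) (hc j)

/-- Symmetrization with an independent copy, then contraction. The copy is split off at once by
convexity, which costs the factor `2` in `signedAverage` but leaves a single index `j`, so that the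
contraction property applies term by term. -/
theorem IsContractive.drawAverage_le_signedAverage (hc : ∀ j, 0 ≤ c j) (hc1 : ∑ j, c j = 1)
    (hg : ∀ j u v, |g j u - g j v| ≤ |t j u - t j v|) (hP : IsContractive P) (Ψ : C(Ω, ℝ)) :
    drawAverage c g P Ψ ≤ _root_.signedAverage c t P Ψ := by
  have half : ∀ x y : C(Ω, ℝ), P ((2⁻¹ : ℝ) • x + (2⁻¹ : ℝ) • y) ≤ 2⁻¹ * P x + 2⁻¹ * P y :=
    fun x y => hP.convexOn.2 (Set.mem_univ x) (Set.mem_univ y) (by norm_num) (by norm_num)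
      (by norm_num)
  have key : ∀ j, P (Ψ + (g j - ∑ i, c i • g i)) ≤
      ∑ i, c i * (2⁻¹ * P (Ψ + (2 : ℝ) • g j) + 2⁻¹ * P (Ψ - (2 : ℝ) • g i)) := by
    intro j
    -- The mean is the average of an independent draw `g i`; Jensen's inequality moves this average
    -- outside `P`.
    have e : Ψ + (g j - ∑ i, c i • g i) = ∑ i, c i • (Ψ + g j - g i) := by
      simp only [smul_sub, Finset.sum_sub_distrib, ← Finset.sum_smul, hc1, one_smul]
      abel
    rw [e]
    refine (hP.convexOn.map_sum_le (fun i _ => hc i) hc1 fun _ _ => Set.mem_univ _).trans ?_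
    refine Finset.sum_le_sum fun i _ => mul_le_mul_of_nonneg_left ?_ (hc i)
    have e' : Ψ + g j - g i =
        (2⁻¹ : ℝ) • (Ψ + (2 : ℝ) • g j) + (2⁻¹ : ℝ) • (Ψ - (2 : ℝ) • g i) := by module
    rw [e']
    exact half _ _
  calc drawAverage c g P Ψ
      ≤ ∑ j, c j * ∑ i, c i * (2⁻¹ * P (Ψ + (2 : ℝ) • g j) + 2⁻¹ * P (Ψ - (2 : ℝ) • g i)) :=
        Finset.sum_le_sum fun j _ => mul_le_mul_of_nonneg_left (key j) (hc j)
    _ = _root_.signedAverage c g P Ψ := by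
        simp only [mul_add, Finset.sum_add_distrib, ← Finset.sum_mul, hc1, one_mul,
          _root_.signedAverage]
    _ ≤ _root_.signedAverage c t P Ψ := by
        refine Finset.sum_le_sum fun j _ => mul_le_mul_of_nonneg_left ?_ (hc j)
        refine mul_le_mul_of_nonneg_left (hP.contract _ _ _ fun u v => ?_) (by norm_num)
        simp only [ContinuousMap.smul_apply, smul_eq_mul, ← mul_sub, abs_mul]
        exact mul_le_mul_of_nonneg_left (hg j u v) (abs_nonneg _)

theorem IsContractive.iterate_signedAverage (hc : ∀ j, 0 ≤ c j) (hP : IsContractive P) (m : ℕ) :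
    IsContractive ((_root_.signedAverage c t)^[m] P) := by
  induction m with
  | zero => exact hP
  | succ m ih =>
    rw [Function.iterate_succ_apply']
    exact ih.signedAverage hc

theorem IsContractive.iterate_drawAverage_le (hc : ∀ j, 0 ≤ c j) (hc1 : ∑ j, c j = 1)
    (hg : ∀ j u v, |g j u - g j v| ≤ |t j u - t j v|) (hP : IsContractive P) (m : ℕ)
    (Ψ : C(Ω, ℝ)) :
    (drawAverage c g)^[m] P Ψ ≤ (_root_.signedAverage c t)^[m] P Ψ := by
  induction m generalizing Ψ with
  | zero => exact le_rfl
  | succ m ih =>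
    rw [Function.iterate_succ_apply', Function.iterate_succ_apply']
    exact (drawAverage_mono hc ih Ψ).trans
      ((hP.iterate_signedAverage hc m).drawAverage_le_signedAverage hc hc1 hg Ψ)

theorem exists_le_of_sum_weights {c x : ι → ℝ} (hc : ∀ j, 0 ≤ c j) (hc1 : ∑ j, c j = 1) :
    ∃ j, x j ≤ ∑ i, c i * x i := by
  by_contra! h
  have h₁ : ∑ j, c j * ∑ i, c i * x i ≤ ∑ j, c j * x j :=
    Finset.sum_le_sum fun j _ => mul_le_mul_of_nonneg_left (h j).le (hc j)
  obtain ⟨j, -, hj⟩ : ∃ j ∈ Finset.univ, 0 < c j := by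
    by_contra! h₂
    have := Finset.sum_nonpos h₂
    linarith
  have h₂ : ∑ j, c j * ∑ i, c i * x i < ∑ j, c j * x j :=
    Finset.sum_lt_sum (fun j _ => mul_le_mul_of_nonneg_left (h j).le (hc j))
      ⟨j, Finset.mem_univ _, mul_lt_mul_of_pos_left (h j) hj⟩
  rw [← Finset.sum_mul, hc1, one_mul] at h₂
  exact lt_irrefl _ h₂

/-- The iterate is the expectation of `P` after `m` independent centred draws, and some outcome does
not exceed the expectation. -/
theorem exists_draws_le (hc : ∀ j, 0 ≤ c j) (hc1 : ∑ j, c j = 1) (m : ℕ) (Ψ : C(Ω, ℝ)) :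
    ∃ k : Fin m → ι, P (Ψ + ∑ i, (g (k i) - ∑ j, c j • g j)) ≤ (drawAverage c g)^[m] P Ψ := by
  induction m generalizing Ψ with
  | zero => exact ⟨Fin.elim0, by simp⟩
  | succ m ih =>
    rw [Function.iterate_succ_apply']
    obtain ⟨j, hj⟩ := exists_le_of_sum_weights
      (x := fun j => (drawAverage c g)^[m] P (Ψ + (g j - ∑ i, c i • g i))) hc hc1
    obtain ⟨k, hk⟩ := ih (Ψ + (g j - ∑ i, c i • g i))
    refine ⟨Fin.cons j k, ?_⟩
    rw [Fin.sum_univ_succ]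
    simp only [Fin.cons_zero, Fin.cons_succ]
    rw [← add_assoc]
    exact hk.trans hj

variable {E : Type*} [NormedAddCommGroup E] [InnerProductSpace ℝ E]

/-- The linear functional `⟨w, ·⟩` on the points `e u`. -/
noncomputable def linearFn (e : C(Ω, E)) (w : E) : C(Ω, ℝ) :=
  ⟨fun u => inner ℝ w (e u), by fun_prop⟩

/-- The ReLU neuron `s σ(⟨w, ·⟩)` on the points `e u`. -/
noncomputable def neuronFn (e : C(Ω, E)) (s : ℝ) (w : E) : C(Ω, ℝ) :=
  ⟨fun u => s * reluFn (inner ℝ w (e u)), by unfold reluFn; fun_prop⟩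

theorem sqrt_add_sqrt_parallelogram_le (x y : E) {q : ℝ} (hq : 0 ≤ q) :
    2⁻¹ * (√(‖x + y‖ ^ 2 + q) + √(‖x - y‖ ^ 2 + q)) ≤ √(‖x‖ ^ 2 + ‖y‖ ^ 2 + q) := by
  have hp := parallelogram_law_with_norm ℝ x y
  have h₁ := Real.sq_sqrt (show 0 ≤ ‖x + y‖ ^ 2 + q by positivity)
  have h₂ := Real.sq_sqrt (show 0 ≤ ‖x - y‖ ^ 2 + q by positivity)
  apply Real.le_sqrt_of_sq_le
  nlinarith [sq_nonneg (√(‖x + y‖ ^ 2 + q) - √(‖x - y‖ ^ 2 + q))]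

/-- Signed draws keep the argument linear, so only its weight vector moves. By the parallelogram law
and concavity of the root, each signed step of length at most `2` adds at most `4` under the root.
-/
theorem iterate_signedAverage_linearFn_le (e : C(Ω, E)) {w : ι → E} (hw : ∀ j, ‖w j‖ ≤ 1)
    (hc : ∀ j, 0 ≤ c j) (hc1 : ∑ j, c j = 1) {r : ℝ} (hr : 0 ≤ r)
    (hP : ∀ w, P (linearFn e w) ≤ r * ‖w‖) (m : ℕ) (w₀ : E) :
    (signedAverage c fun j => linearFn e (w j))^[m] P (linearFn e w₀) ≤
      r * √(‖w₀‖ ^ 2 + 4 * m) := by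
  induction m generalizing w₀ with
  | zero => simpa using hP w₀
  | succ m ih =>
    rw [Function.iterate_succ_apply']
    have key : ∀ j, 2⁻¹ *
        ((signedAverage c fun j => linearFn e (w j))^[m] P
            (linearFn e w₀ + (2 : ℝ) • linearFn e (w j)) +
          (signedAverage c fun j => linearFn e (w j))^[m] P
            (linearFn e w₀ - (2 : ℝ) • linearFn e (w j))) ≤
        r * √(‖w₀‖ ^ 2 + 4 * (m + 1 : ℕ)) := by
      intro j
      have e₁ : linearFn e w₀ + (2 : ℝ) • linearFn e (w j) =
          linearFn e (w₀ + (2 : ℝ) • w j) := by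
        ext u; simp [linearFn, inner_add_left, inner_smul_left]
      have e₂ : linearFn e w₀ - (2 : ℝ) • linearFn e (w j) =
          linearFn e (w₀ - (2 : ℝ) • w j) := by
        ext u; simp [linearFn, inner_sub_left, inner_smul_left]
      rw [e₁, e₂]
      have h₁ := ih (w₀ + (2 : ℝ) • w j)
      have h₂ := ih (w₀ - (2 : ℝ) • w j)
      have h₃ := mul_le_mul_of_nonneg_left (sqrt_add_sqrt_parallelogram_le w₀ ((2 : ℝ) • w j)
        (show (0 : ℝ) ≤ 4 * m by positivity)) hr
      have h₄ : √(‖w₀‖ ^ 2 + ‖(2 : ℝ) • w j‖ ^ 2 + 4 * m) ≤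
          √(‖w₀‖ ^ 2 + 4 * (m + 1 : ℕ)) := by
        apply Real.sqrt_le_sqrt
        rw [norm_smul, Real.norm_eq_abs, abs_two]
        push_cast
        have := hw j
        nlinarith [norm_nonneg (w j)]
      have h₅ := mul_le_mul_of_nonneg_left h₄ hr
      linarith
    calc _ ≤ ∑ j, c j * (r * √(‖w₀‖ ^ 2 + 4 * (m + 1 : ℕ))) :=
          Finset.sum_le_sum fun j _ => mul_le_mul_of_nonneg_left (key j) (hc j)
      _ = _ := by rw [← Finset.sum_mul, hc1, one_mul]

theorem abs_reluFn_sub_le (x y : ℝ) : |reluFn x - reluFn y| ≤ |x - y| :=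
  abs_max_sub_max_le_abs x y 0

/-- A convex combination of unit neurons on a set of radius `r` is an average of `m` of them up to
an error `4 r / √m`. -/
theorem exists_neurons_of_convex_combination [CompactSpace Ω] (e : C(Ω, E)) {o : Ω} (ho : e o = 0)
    {r : ℝ} (hr : 0 ≤ r) (her : ∀ u, ‖e u‖ ≤ r) {s : ι → ℝ} (hs : ∀ j, |s j| ≤ 1) {w : ι → E}
    (hw : ∀ j, ‖w j‖ ≤ 1) (hc : ∀ j, 0 ≤ c j) (hc1 : ∑ j, c j = 1) {m : ℕ} (hm : 1 ≤ m) :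
    ∃ k : Fin m → ι, ∀ u, |(∑ j, c j • neuronFn e (s j) (w j)) u -
      ∑ i, (m : ℝ)⁻¹ * s (k i) * reluFn (inner ℝ (w (k i)) (e u))| ≤ 4 * r / √m := by
  classical
  have : Nonempty Ω := ⟨o⟩
  set F := ∑ j, c j • neuronFn e (s j) (w j) with hF
  -- The oscillation of `Ψ`, in place of the uniform norm, as a sum of suprema of contractive type.
  -- It bounds `|Ψ|` for functions that vanish somewhere, here at `o`.
  let P : C(Ω, ℝ) → ℝ := fun Ψ => (⨆ u, Ψ u) + ⨆ u, (-Ψ) u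
  have hP : IsContractive P := isContractive_iSup.add isContractive_iSup.comp_neg
  have hPlin : ∀ w, P (linearFn e w) ≤ (2 * r) * ‖w‖ := by
    intro w
    have h : ∀ u, |inner ℝ w (e u)| ≤ r * ‖w‖ := fun u =>
      (abs_real_inner_le_norm _ _).trans (by
        rw [mul_comm]; exact mul_le_mul_of_nonneg_right (her u) (norm_nonneg _))
    have h₁ : ⨆ u, (linearFn e w) u ≤ r * ‖w‖ := ciSup_le fun u => (le_abs_self _).trans (h u)
    have h₂ : ⨆ u, (-linearFn e w) u ≤ r * ‖w‖ := ciSup_le fun u => (neg_le_abs _).trans (h u)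
    simp only [P]
    linarith
  have hlip : ∀ j u v, |neuronFn e (s j) (w j) u - neuronFn e (s j) (w j) v| ≤
      |linearFn e (w j) u - linearFn e (w j) v| := by
    intro j u v
    change |s j * _ - s j * _| ≤ _
    rw [← mul_sub, abs_mul]
    exact (mul_le_of_le_one_left (abs_nonneg _) (hs j)).trans (abs_reluFn_sub_le _ _)
  obtain ⟨k, hk⟩ := exists_draws_le (P := P) (g := fun j => neuronFn e (s j) (w j)) hc hc1 m 0
  refine ⟨k, fun u => ?_⟩
  have h₀ := iterate_signedAverage_linearFn_le e hw hc hc1 (by positivity) hPlin m 0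
  rw [show linearFn e (0 : E) = 0 by ext; simp [linearFn]] at h₀
  have h₁ := (hk.trans (hP.iterate_drawAverage_le hc hc1 hlip m 0)).trans h₀
  have hm' : (0 : ℝ) < m := by exact_mod_cast hm
  have h4 : √(‖(0 : E)‖ ^ 2 + 4 * m) = 2 * √m := by
    rw [norm_zero, zero_pow two_ne_zero, zero_add, Real.sqrt_mul (by norm_num),
      show (4 : ℝ) = 2 ^ 2 by norm_num, Real.sqrt_sq (by norm_num)]
  rw [h4, zero_add] at h₁
  set Φ := ∑ i, (neuronFn e (s (k i)) (w (k i)) - ∑ j, c j • neuronFn e (s j) (w j)) with hΦ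
  have hΦu : ∀ u, Φ u = ∑ i, s (k i) * reluFn (inner ℝ (w (k i)) (e u)) - m * F u := by
    intro u
    rw [hΦ, ← hF, Finset.sum_sub_distrib]
    simp [neuronFn, ContinuousMap.sum_apply]
  have hF0 : F o = 0 := by
    simp [hF, ContinuousMap.sum_apply, neuronFn, ho, reluFn]
  have hΦo : Φ o = 0 := by
    rw [hΦu, hF0]; simp [ho, reluFn]
  have hΦle : |Φ u| ≤ 4 * r * √m := by
    have a₁ := Φ.apply_le_iSup u
    have a₂ := Φ.apply_le_iSup o
    have a₃ := (-Φ).apply_le_iSup u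
    have a₄ := (-Φ).apply_le_iSup o
    simp only [P] at h₁
    simp only [ContinuousMap.neg_apply, hΦo] at a₂ a₃ a₄ h₁
    rw [abs_le]
    constructor <;> linarith
  have e₁ : F u - ∑ i, (m : ℝ)⁻¹ * s (k i) * reluFn (inner ℝ (w (k i)) (e u)) =
      -((m : ℝ)⁻¹ * Φ u) := by
    rw [hΦu]
    simp only [mul_assoc, ← Finset.mul_sum]
    field_simp
    ring
  rw [e₁, abs_neg, abs_mul, abs_of_pos (inv_pos.2 hm')]
  calc (m : ℝ)⁻¹ * |Φ u| ≤ (m : ℝ)⁻¹ * (4 * r * √m) :=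
        mul_le_mul_of_nonneg_left hΦle (inv_nonneg.2 hm'.le)
    _ = 4 * r / √m := by
        have := Real.mul_self_sqrt hm'.le
        have h0 : 0 < √(m : ℝ) := Real.sqrt_pos.2 hm'
        rw [inv_mul_eq_div, div_eq_div_iff hm'.ne' h0.ne', mul_assoc, this]

end Sampling

/-! ### Barron functions as limits of convex combinations of neurons. -/

section Barron

variable {ι : Type}

/-- The homogenised weight `(b, c)` of the neuron `σ(⟨b, ·⟩ + c)`. -/
noncomputable def augment (b : EuclideanSpace ℝ ι) (c : ℝ) : WithLp 2 (EuclideanSpace ℝ ι × ℝ) :=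
  WithLp.toLp 2 (b, c)

theorem continuous_augment :
    Continuous fun q : EuclideanSpace ℝ ι × ℝ => augment q.1 q.2 :=
  WithLp.prod_continuous_toLp 2 _ _

variable [Fintype ι]

theorem inner_augment (b v : EuclideanSpace ℝ ι) (c t : ℝ) :
    inner ℝ (augment b c) (augment v t) = inner ℝ b v + c * t := by
  simp [augment, WithLp.prod_inner_apply, mul_comm]

theorem norm_augment_sq (b : EuclideanSpace ℝ ι) (c : ℝ) :
    ‖augment b c‖ ^ 2 = ‖b‖ ^ 2 + c ^ 2 := by
  rw [augment, WithLp.prod_norm_sq_eq_of_L2]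
  simp

theorem EuclideanSpace.norm_le_sum_abs (b : EuclideanSpace ℝ ι) : ‖b‖ ≤ ∑ i, |b i| := by
  rw [EuclideanSpace.norm_eq]
  apply Real.sqrt_le_iff.2
  refine ⟨Finset.sum_nonneg fun _ _ => abs_nonneg _, ?_⟩
  simp only [Real.norm_eq_abs]
  exact Finset.sum_sq_le_sq_sum_of_nonneg fun _ _ => abs_nonneg _

/-- The path norm `|a| (‖b‖₁ + |c|)` of a neuron. -/
noncomputable def pathNorm (θ : ℝ × EuclideanSpace ℝ ι × ℝ) : ℝ :=
  |θ.1| * ((∑ i, |θ.2.1 i|) + |θ.2.2|)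

theorem continuous_pathNorm : Continuous (pathNorm (ι := ι)) := by
  unfold pathNorm
  fun_prop

theorem pathNorm_nonneg (θ : ℝ × EuclideanSpace ℝ ι × ℝ) : 0 ≤ pathNorm θ := by
  unfold pathNorm
  positivity

theorem norm_augment_le (b : EuclideanSpace ℝ ι) (c : ℝ) :
    ‖augment b c‖ ≤ (∑ i, |b i|) + |c| := by
  have h := EuclideanSpace.norm_le_sum_abs b
  apply le_of_sq_le_sq _ (by positivity)
  rw [norm_augment_sq, ← sq_abs c]
  nlinarith [norm_nonneg b, abs_nonneg c]

theorem reluFn_mul_of_nonneg {c : ℝ} (hc : 0 ≤ c) (x : ℝ) : reluFn (c * x) = c * reluFn x := by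
  unfold reluFn
  rw [mul_max_of_nonneg _ _ hc, mul_zero]

theorem abs_reluFn_le (x : ℝ) : |reluFn x| ≤ |x| := by
  simpa [reluFn] using abs_reluFn_sub_le x 0

variable {Ω : Type*} [TopologicalSpace Ω]

/-- Neurons with outer weight at most `1` and inner weight in the unit ball. -/
def unitNeurons {E : Type*} [NormedAddCommGroup E] [InnerProductSpace ℝ E] (e : C(Ω, E)) :
    Set C(Ω, ℝ) :=
  {g | ∃ s w, |s| ≤ 1 ∧ ‖w‖ ≤ 1 ∧ g = neuronFn e s w}

/-- Positive homogeneity of the ReLU moves the size of the inner weight outside. If that size is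
zero the neuron vanishes, and the convention `0⁻¹ = 0` keeps the formula valid. -/
theorem exists_neuronFn_eq_smul (e : C(Ω, WithLp 2 (EuclideanSpace ℝ ι × ℝ)))
    (θ : ℝ × EuclideanSpace ℝ ι × ℝ) :
    ∃ g ∈ unitNeurons e, neuronFn e θ.1 (augment θ.2.1 θ.2.2) = pathNorm θ • g := by
  obtain ⟨a, b, c⟩ := θ
  set N := (∑ i, |b i|) + |c| with hN
  have hN0 : 0 ≤ N := by positivity
  have hle : ‖augment b c‖ ≤ N := norm_augment_le b c
  refine ⟨neuronFn e (SignType.sign a : ℝ) (N⁻¹ • augment b c), ⟨_, _, ?_, ?_, rfl⟩, ?_⟩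
  · rcases lt_trichotomy a 0 with h | h | h <;> simp [h]
  · rw [norm_smul, Real.norm_eq_abs, abs_of_nonneg (inv_nonneg.2 hN0)]
    exact inv_mul_le_one_of_le₀ hle hN0
  · ext u
    change a * reluFn _ = (|a| * N) * ((SignType.sign a : ℝ) * reluFn _)
    rw [real_inner_smul_left, reluFn_mul_of_nonneg (inv_nonneg.2 hN0)]
    rcases hN0.eq_or_lt with h | h
    · have : augment b c = 0 := norm_le_zero_iff.1 (hle.trans h.ge)
      simp [this, reluFn]
    · have h₁ : |a| * (SignType.sign a : ℝ) = a := abs_mul_sign a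
      calc _ = (|a| * (SignType.sign a : ℝ)) * reluFn (inner ℝ (augment b c) (e u)) := by rw [h₁]
        _ = _ := by field_simp

theorem continuous_neuronFn_augment (e : C(Ω, WithLp 2 (EuclideanSpace ℝ ι × ℝ))) :
    Continuous fun θ : ℝ × EuclideanSpace ℝ ι × ℝ => neuronFn e θ.1 (augment θ.2.1 θ.2.2) := by
  refine ContinuousMap.continuous_of_continuous_uncurry _ ?_
  have h : Continuous fun q : (ℝ × EuclideanSpace ℝ ι × ℝ) × Ω => augment q.1.2.1 q.1.2.2 :=
    continuous_augment.comp (by fun_prop)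
  simp only [Function.uncurry_def, neuronFn, ContinuousMap.coe_mk, reluFn]
  fun_prop

variable [CompactSpace Ω]

theorem norm_neuronFn_augment_le (e : C(Ω, WithLp 2 (EuclideanSpace ℝ ι × ℝ))) {r : ℝ}
    (hr : 0 ≤ r) (her : ∀ u, ‖e u‖ ≤ r) (θ : ℝ × EuclideanSpace ℝ ι × ℝ) :
    ‖neuronFn e θ.1 (augment θ.2.1 θ.2.2)‖ ≤ pathNorm θ * r := by
  rw [ContinuousMap.norm_le _ (mul_nonneg (pathNorm_nonneg θ) hr)]
  intro u
  change ‖θ.1 * reluFn _‖ ≤ _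
  rw [norm_mul, Real.norm_eq_abs, Real.norm_eq_abs, pathNorm, mul_assoc]
  refine mul_le_mul_of_nonneg_left ?_ (abs_nonneg _)
  refine (abs_reluFn_le _).trans ((abs_real_inner_le_norm _ _).trans ?_)
  exact mul_le_mul (norm_augment_le _ _) (her u) (norm_nonneg _) (by positivity)

theorem integrable_neuronFn_augment (e : C(Ω, WithLp 2 (EuclideanSpace ℝ ι × ℝ))) {r : ℝ}
    (hr : 0 ≤ r) (her : ∀ u, ‖e u‖ ≤ r) {μ : Measure (ℝ × EuclideanSpace ℝ ι × ℝ)}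
    (hμ : Integrable pathNorm μ) :
    Integrable (fun θ => neuronFn e θ.1 (augment θ.2.1 θ.2.2)) μ :=
  (hμ.mul_const r).mono' (continuous_neuronFn_augment e).aestronglyMeasurable
    (Filter.Eventually.of_forall (norm_neuronFn_augment_le e hr her))

/-- A superposition of neurons of total path norm at most `B` lies in `B` times the closed convex
hull of the unit neurons. -/
theorem inv_smul_integral_mem_closure_convexHull (e : C(Ω, WithLp 2 (EuclideanSpace ℝ ι × ℝ)))
    {r : ℝ} (hr : 0 ≤ r) (her : ∀ u, ‖e u‖ ≤ r) {μ : Measure (ℝ × EuclideanSpace ℝ ι × ℝ)}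
    (hμ : Integrable pathNorm μ) {B : ℝ} (hB : 0 < B) (hμB : ∫ θ, pathNorm θ ∂μ ≤ B) :
    B⁻¹ • ∫ θ, neuronFn e θ.1 (augment θ.2.1 θ.2.2) ∂μ ∈
      closure (convexHull ℝ (unitNeurons e)) := by
  by_contra hmem
  obtain ⟨l, u, hl, hu⟩ := geometric_hahn_banach_closed_point
    (convex_convexHull ℝ (unitNeurons e)).closure isClosed_closure hmem
  have hl' : ∀ g ∈ unitNeurons e, l g < u := fun g hg =>
    hl g (subset_closure (subset_convexHull ℝ _ hg))
  -- The zero function is itself a unit neuron. Nonnegativity of `u` is what allows the total path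
  -- norm to be replaced by its upper bound `B`.
  have hu0 : 0 ≤ u := by
    have h := hl' (neuronFn e 0 0) ⟨0, 0, by simp, by simp, rfl⟩
    rw [show neuronFn e 0 0 = 0 by ext; simp [neuronFn], map_zero] at h
    exact h.le
  have hint := integrable_neuronFn_augment e hr her hμ
  have hle : l (∫ θ, neuronFn e θ.1 (augment θ.2.1 θ.2.2) ∂μ) ≤ B * u := by
    rw [← l.integral_comp_comm hint]
    calc _ ≤ ∫ θ, pathNorm θ * u ∂μ := by
          refine integral_mono (l.integrable_comp hint) (hμ.mul_const u) fun θ => ?_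
          obtain ⟨g, hg, h⟩ := exists_neuronFn_eq_smul e θ
          simp only [h, map_smul, smul_eq_mul]
          exact mul_le_mul_of_nonneg_left (hl' g hg).le (pathNorm_nonneg θ)
      _ ≤ B * u := by
          rw [integral_mul_const]
          exact mul_le_mul_of_nonneg_right hμB hu0
  rw [map_smul, smul_eq_mul] at hu
  have := mul_le_mul_of_nonneg_left hle (inv_nonneg.2 hB.le)
  rw [inv_mul_cancel_left₀ hB.ne'] at this
  exact absurd hu (not_lt.2 this)

theorem exists_neurons_of_mem_closure_convexHull {E : Type*} [NormedAddCommGroup E]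
    [InnerProductSpace ℝ E] (e : C(Ω, E)) {o : Ω} (ho : e o = 0)
    {r : ℝ} (hr : 0 < r) (her : ∀ u, ‖e u‖ ≤ r) {F : C(Ω, ℝ)}
    (hF : F ∈ closure (convexHull ℝ (unitNeurons e))) {m : ℕ} (hm : 1 ≤ m) :
    ∃ (s : Fin m → ℝ) (w : Fin m → E), ∀ u, |F u - ∑ i, s i * reluFn (inner ℝ (w i) (e u))| ≤
      5 * r / √m := by
  have hm' : (0 : ℝ) < √m := Real.sqrt_pos.2 (by exact_mod_cast hm)
  -- Passing from the closure to the hull may cost as much as the sampling error itself: `4 + 1 =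
  -- 5`.
  obtain ⟨G, hG, hGF⟩ := Metric.mem_closure_iff.1 hF (r / √m) (by positivity)
  obtain ⟨κ, t, c, g, hc, hc1, hg, hcg⟩ := (mem_convexHull_iff_exists_fintype).1 hG
  choose s w hs hw hsw using hg
  obtain ⟨k, hk⟩ := exists_neurons_of_convex_combination e ho hr.le her hs hw hc hc1 hm
  refine ⟨fun i => (m : ℝ)⁻¹ * s (k i), fun i => w (k i), fun u => ?_⟩
  have h₁ := hk u
  simp only [← hsw, hcg] at h₁
  have h₂ : |F u - G u| ≤ r / √m := by
    rw [← Real.dist_eq]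
    exact (ContinuousMap.dist_apply_le_dist u).trans hGF.le
  calc _ ≤ |F u - G u| + |G u - ∑ i, (m : ℝ)⁻¹ * s (k i) * reluFn (inner ℝ (w (k i)) (e u))| :=
        abs_sub_le _ _ _
    _ ≤ r / √m + 4 * r / √m := add_le_add h₂ h₁
    _ = _ := by ring

theorem exists_integrable_pathNorm_of_barronNorm_lt {p : ℝ≥0∞} (hp : 1 ≤ p)
    {X : Set (EuclideanSpace ℝ ι)} {f : EuclideanSpace ℝ ι → ℝ} {B : ℝ}
    (hB : barronNorm p X f < ENNReal.ofReal B) :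
    ∃ μ, IsBarronRep X f μ ∧ Integrable pathNorm μ ∧ ∫ θ, pathNorm θ ∂μ ≤ B := by
  unfold barronNorm at hB
  simp only [iInf_lt_iff] at hB
  obtain ⟨μ, hμ, hlt⟩ := hB
  have := hμ.1
  have hm : AEStronglyMeasurable (pathNorm (ι := ι)) μ := continuous_pathNorm.aestronglyMeasurable
  have h1 : eLpNorm pathNorm 1 μ < ENNReal.ofReal B :=
    (eLpNorm_le_eLpNorm_of_exponent_le hp hm).trans_lt hlt
  have hB0 : 0 < B := by
    by_contra! h
    rw [ENNReal.ofReal_of_nonpos h] at h1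
    exact not_lt_zero h1
  have hint : Integrable pathNorm μ := memLp_one_iff_integrable.1 ⟨hm, h1.trans ENNReal.ofReal_lt_top⟩
  refine ⟨μ, hμ, hint, ?_⟩
  have h2 : ∫ θ, pathNorm θ ∂μ = (eLpNorm pathNorm 1 μ).toReal := by
    rw [eLpNorm_one_eq_lintegral_enorm, ← integral_norm_eq_lintegral_enorm hm]
    simp only [Real.norm_eq_abs, abs_of_nonneg (pathNorm_nonneg _)]
  rw [h2]
  exact ENNReal.toReal_le_of_le_ofReal hB0.le h1.le

/-- Dimension-free approximation of a Barron function by a network of width `m`. -/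
theorem exists_network_of_barronNorm_lt {p : ℝ≥0∞} (hp : 1 ≤ p)
    {X : Set (EuclideanSpace ℝ ι)} {f : EuclideanSpace ℝ ι → ℝ} {B : ℝ}
    (hB : barronNorm p X f < ENNReal.ofReal B) {r : ℝ} (hr : 0 < r) {m : ℕ} (hm : 1 ≤ m) :
    ∃ (a : Fin m → ℝ) (b : Fin m → EuclideanSpace ℝ ι) (c : Fin m → ℝ),
      ∀ v ∈ X, ‖v‖ ^ 2 + 1 ≤ r ^ 2 →
        |f v - ∑ k, a k * reluFn (inner ℝ (b k) v + c k)| ≤ B * (5 * r / √m) := by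
  obtain ⟨μ, hμ, hint, hle⟩ := exists_integrable_pathNorm_of_barronNorm_lt hp hB
  have hB0 : 0 < B := by
    by_contra! h
    rw [ENNReal.ofReal_of_nonpos h] at hB
    exact not_lt_zero hB
  -- The points of interest are `augment v 1`, but a whole ball is used: it is compact and contains
  -- the origin, where every homogenised neuron vanishes. The integral representation defines the
  -- function there even when `X` is smaller.
  let Ω := Metric.closedBall (0 : WithLp 2 (EuclideanSpace ℝ ι × ℝ)) r
  have : CompactSpace Ω := isCompact_iff_compactSpace.1 (isCompact_closedBall _ _)
  let e : C(Ω, WithLp 2 (EuclideanSpace ℝ ι × ℝ)) := ⟨Subtype.val, continuous_subtype_val⟩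
  have her : ∀ u, ‖e u‖ ≤ r := fun u => mem_closedBall_zero_iff.1 u.2
  obtain ⟨s, w, hsw⟩ := exists_neurons_of_mem_closure_convexHull e
    (o := ⟨0, Metric.mem_closedBall_self hr.le⟩) rfl hr her
    (inv_smul_integral_mem_closure_convexHull e hr.le her hint hB0 hle) hm
  refine ⟨fun k => B * s k, fun k => (w k).fst, fun k => (w k).snd, fun v hv hvr => ?_⟩
  have hu : augment v 1 ∈ Ω := by
    rw [mem_closedBall_zero_iff]
    apply le_of_sq_le_sq _ hr.le
    rw [norm_augment_sq, one_pow]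
    exact hvr
  have hw : ∀ k, inner ℝ (w k) (augment v 1) = inner ℝ (w k).fst v + (w k).snd := fun k => by
    have := inner_augment (w k).fst v (w k).snd 1
    rwa [mul_one] at this
  have h := hsw ⟨_, hu⟩
  have hF : (∫ θ, neuronFn e θ.1 (augment θ.2.1 θ.2.2) ∂μ) ⟨_, hu⟩ = f v := by
    rw [(hμ.2 v hv).2]
    have h₁ := (ContinuousMap.evalCLM ℝ (⟨_, hu⟩ : Ω)).integral_comp_comm
      (integrable_neuronFn_augment e hr.le her hint)
    refine h₁.symm.trans (integral_congr_ae (Filter.Eventually.of_forall fun θ => ?_))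
    change θ.1 * reluFn (inner ℝ (augment θ.2.1 θ.2.2) (augment v 1)) = _
    rw [inner_augment, mul_one]
  rw [ContinuousMap.smul_apply, hF] at h
  change |B⁻¹ • f v - ∑ i, s i * reluFn (inner ℝ (w i) (augment v 1))| ≤ _ at h
  simp only [hw] at h
  have e₁ : f v - ∑ k, B * s k * reluFn (inner ℝ (w k).fst v + (w k).snd) =
      B * (B⁻¹ • f v - ∑ i, s i * reluFn (inner ℝ (w i).fst v + (w i).snd)) := by
    rw [mul_sub, smul_eq_mul, mul_inv_cancel_left₀ hB0.ne', Finset.mul_sum]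
    simp only [mul_assoc]
  rw [e₁, abs_mul, abs_of_pos hB0]
  exact mul_le_mul_of_nonneg_left h hB0.le

/-- The infimum need not be attained, so the network bound is applied with a constant strictly above
the Barron norm. When the norm is zero no multiple of it will do, and this case is settled
separately. -/
theorem eq_zero_of_barronNorm_eq_zero {p : ℝ≥0∞} (hp : 1 ≤ p)
    {X : Set (EuclideanSpace ℝ ι)} {f : EuclideanSpace ℝ ι → ℝ} (hf : barronNorm p X f = 0)
    {v : EuclideanSpace ℝ ι} (hv : v ∈ X) : f v = 0 := by
  have key : ∀ B > 0, |f v| ≤ B * ‖augment v 1‖ := by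
    intro B hB
    obtain ⟨μ, hμ, hint, hle⟩ := exists_integrable_pathNorm_of_barronNorm_lt hp
      (hf.trans_lt (ENNReal.ofReal_pos.2 hB))
    rw [(hμ.2 v hv).2, ← Real.norm_eq_abs]
    calc _ ≤ ∫ θ, pathNorm θ * ‖augment v 1‖ ∂μ := by
          refine norm_integral_le_of_norm_le (hint.mul_const _)
            (Filter.Eventually.of_forall fun θ => ?_)
          have h := norm_neuronFn_augment_le (Ω := Unit) (ContinuousMap.const _ (augment v 1))
            (norm_nonneg _) (fun _ => le_rfl) θ
          refine le_trans ?_ h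
          refine le_trans (le_of_eq ?_) (ContinuousMap.norm_coe_le_norm _ ())
          change _ = ‖θ.1 * reluFn (inner ℝ (augment θ.2.1 θ.2.2) (augment v 1))‖
          rw [inner_augment, mul_one]
      _ ≤ _ := by
          rw [integral_mul_const]
          exact mul_le_mul_of_nonneg_right hle (norm_nonneg _)
  by_contra h
  have hpos : 0 < |f v| := abs_pos.2 h
  have h1 := key (|f v| / (2 * (‖augment v 1‖ + 1))) (by positivity)
  have : |f v| / (2 * (‖augment v 1‖ + 1)) * ‖augment v 1‖ < |f v| := by
    rw [div_mul_eq_mul_div, div_lt_iff₀ (by positivity)]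
    nlinarith [norm_nonneg (augment v 1)]
  linarith

end Barron

/-! ### Interpolation at lacunary nodes -/

section Lacunary

open Finset Polynomial

theorem half_le_prod_one_sub_pow (n : ℕ) :
    (1 : ℝ) / 2 ≤ ∏ i ∈ range n, (1 - (1 / 3 : ℝ) ^ (i + 1)) := by
  -- The bound `1 / 2` alone does not propagate through the induction; the extra decaying term
  -- absorbs the next factor.
  suffices h : (1 : ℝ) / 2 + 1 / 2 * (1 / 3) ^ n ≤ ∏ i ∈ range n, (1 - (1 / 3 : ℝ) ^ (i + 1)) by
    have : (0 : ℝ) < (1 / 3) ^ n := by positivity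
    linarith
  induction n with
  | zero => norm_num
  | succ n ih =>
    rw [prod_range_succ]
    have h0 : (0 : ℝ) < (1 / 3) ^ n := by positivity
    have h1 : ((1 : ℝ) / 3) ^ n ≤ 1 := pow_le_one₀ (by norm_num) (by norm_num)
    have h2 := mul_le_mul_of_nonneg_right ih (show 0 ≤ 1 - (1 / 3 : ℝ) ^ (n + 1) by
      rw [pow_succ]; linarith)
    refine le_trans ?_ h2
    rw [pow_succ]
    nlinarith

theorem lacunary_le {u : ℕ → ℝ} {N : ℕ} (hu : ∀ i, i + 1 < N → 3 * u (i + 1) ≤ u i) (i k : ℕ)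
    (h : i + k < N) : u (i + k) ≤ (1 / 3) ^ k * u i := by
  induction k with
  | zero => simp
  | succ k ih =>
    have h₁ := hu (i + k) (by omega)
    have h₂ := ih (by omega)
    rw [pow_succ, ← add_assoc]
    linarith

/-- Nodes larger than `u τ` contribute factors at most `(1 - 3 ^ (-k))⁻¹`, `k = τ - j`, whose
product is bounded by `2`. Each node smaller than `u τ` contributes at most `u j / (u τ - u j) ≤ 1 /
2`. -/
theorem abs_eval_lagrange_basis_le {u : ℕ → ℝ} {N : ℕ} (hpos : ∀ i, 0 < u i)
    (hu : ∀ i, i + 1 < N → 3 * u (i + 1) ≤ u i) {τ : ℕ} (hτ : τ < N) {x : ℝ} (hx : 0 ≤ x)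
    (hxN : x ≤ u (N - 1)) :
    |(Lagrange.basis (range N) u τ).eval x| ≤ 2 * (1 / 2) ^ (N - 1 - τ) := by
  have hxj : ∀ j < N, x ≤ u j := by
    intro j hj
    have h := lacunary_le hu j (N - 1 - j) (by omega)
    rw [show j + (N - 1 - j) = N - 1 by omega] at h
    refine hxN.trans (h.trans (mul_le_of_le_one_left (hpos j).le ?_))
    exact pow_le_one₀ (by norm_num) (by norm_num)
  have hset : (range N).erase τ = range τ ∪ Ico (τ + 1) N := by
    ext j
    simp only [mem_erase, mem_range, mem_union, mem_Ico]
    omega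
  have hdisj : Disjoint (range τ) (Ico (τ + 1) N) := by
    rw [disjoint_left]
    intro j
    simp only [mem_range, mem_Ico]
    omega
  have hev : |(Lagrange.basis (range N) u τ).eval x| =
      ∏ j ∈ (range N).erase τ, |(u τ - u j)⁻¹ * (x - u j)| := by
    simp [Lagrange.basis, Lagrange.basisDivisor, eval_prod, abs_prod]
  rw [hev, hset, prod_union hdisj]
  refine mul_le_mul ?_ ?_ (prod_nonneg fun _ _ => abs_nonneg _) (by norm_num)
  · have h₁ : ∀ j ∈ range τ, |(u τ - u j)⁻¹ * (x - u j)| ≤ (1 - (1 / 3 : ℝ) ^ (τ - j))⁻¹ := by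
      intro j hj
      rw [mem_range] at hj
      have h := lacunary_le hu j (τ - j) (by omega)
      rw [show j + (τ - j) = τ by omega] at h
      have hlt : (1 / 3 : ℝ) ^ (τ - j) < 1 := pow_lt_one₀ (by norm_num) (by norm_num) (by omega)
      have hp := hpos j
      have hd : (1 - (1 / 3 : ℝ) ^ (τ - j)) * u j ≤ u j - u τ := by linarith
      have hd0 : 0 < (1 - (1 / 3 : ℝ) ^ (τ - j)) * u j := mul_pos (by linarith) hp
      rw [abs_mul, abs_inv, abs_sub_comm, abs_of_pos (hd0.trans_le hd), abs_sub_comm,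
        abs_of_nonneg (sub_nonneg.2 (hxj j (by omega)))]
      rw [inv_mul_le_iff₀ (hd0.trans_le hd), ← div_eq_mul_inv, le_div_iff₀ (by linarith)]
      nlinarith [mul_nonneg hx (sub_pos.2 hlt).le]
    refine (prod_le_prod (fun _ _ => abs_nonneg _) h₁).trans ?_
    have h₂ : ∏ j ∈ range τ, (1 - (1 / 3 : ℝ) ^ (τ - j))⁻¹ =
        (∏ i ∈ range τ, (1 - (1 / 3 : ℝ) ^ (i + 1)))⁻¹ := by
      rw [← prod_inv_distrib, ← prod_range_reflect]
      refine prod_congr rfl fun j hj => ?_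
      rw [mem_range] at hj
      rw [show τ - (τ - 1 - j) = j + 1 by omega]
    rw [h₂]
    exact inv_le_of_inv_le₀ (by norm_num) (by simpa using half_le_prod_one_sub_pow τ)
  · have h₁ : ∀ j ∈ Ico (τ + 1) N, |(u τ - u j)⁻¹ * (x - u j)| ≤ 1 / 2 := by
      intro j hj
      rw [mem_Ico] at hj
      have h := lacunary_le hu τ (j - τ) (by omega)
      rw [show τ + (j - τ) = j by omega] at h
      have hle : (1 / 3 : ℝ) ^ (j - τ) ≤ 1 / 3 :=
        pow_le_of_le_one (by norm_num) (by norm_num) (by omega)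
      have hj0 := hpos j
      have h3 : 3 * u j ≤ u τ := by nlinarith [hpos τ]
      have hxj' := hxj j hj.2
      rw [abs_mul, abs_inv, abs_of_pos (show 0 < u τ - u j by linarith), abs_sub_comm,
        abs_of_nonneg (sub_nonneg.2 hxj'), inv_mul_le_iff₀ (by linarith)]
      linarith
    refine (prod_le_prod (fun _ _ => abs_nonneg _) h₁).trans ?_
    rw [prod_const, Nat.card_Ico, show N - (τ + 1) = N - 1 - τ by omega]

/-- Values prescribed at `N` lacunary nodes are interpolated by a combination of the first `N`
powers which stays small past the last node. -/
theorem exists_lacunary_interpolation {u : ℕ → ℝ} {N : ℕ} (hN : 1 ≤ N) (hpos : ∀ i, 0 < u i)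
    (hu : ∀ i, i + 1 < N → 3 * u (i + 1) ≤ u i) (htail : ∀ i, N ≤ i → u i ≤ u (N - 1))
    (a : ℕ → ℝ) {A : ℝ} (hA : ∀ i < N, |a i| * u (N - 1) ≤ A * u i) :
    ∃ α : Fin N → ℝ, (∀ i < N, ∑ h, α h * u i ^ (h.val + 1) = a i) ∧
      ∀ i, N ≤ i → |∑ h, α h * u i ^ (h.val + 1)| ≤ 4 * A * (u i / u (N - 1)) := by
  have hinj : Set.InjOn u (range N) := by
    have hlt : ∀ i j, i < j → j < N → u j < u i := by
      intro i j hij hj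
      have h := lacunary_le hu i (j - i) (by omega)
      rw [show i + (j - i) = j by omega] at h
      have hle : (1 / 3 : ℝ) ^ (j - i) < 1 := pow_lt_one₀ (by norm_num) (by norm_num) (by omega)
      nlinarith [hpos i]
    intro i hi j hj hij
    simp only [coe_range, Set.mem_Iio] at hi hj
    rcases lt_trichotomy i j with h | h | h
    · exact absurd hij (hlt i j h hj).ne'
    · exact h
    · exact absurd hij (hlt j i h hi).ne
  -- Dividing by the node makes room for the missing constant term: the available powers start at `u
  -- ^ 1`.
  set Q := Lagrange.interpolate (range N) u fun i => a i / u i with hQ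
  have hdeg : Q.natDegree < N := by
    have h := Lagrange.degree_interpolate_lt (r := fun i => a i / u i) hinj
    rw [card_range] at h
    rcases eq_or_ne Q 0 with h0 | h0
    · rw [h0, natDegree_zero]
      omega
    · exact (natDegree_lt_iff_degree_lt h0).2 h
  have hsum : ∀ x : ℝ, ∑ h : Fin N, Q.coeff h * x ^ (h.val + 1) = x * Q.eval x := by
    intro x
    rw [eval_eq_sum_range' hdeg, mul_sum, Fin.sum_univ_eq_sum_range
      (fun h => Q.coeff h * x ^ (h + 1)) N]
    exact sum_congr rfl fun h _ => by ring
  refine ⟨fun h => Q.coeff h, fun i hi => ?_, fun i hi => ?_⟩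
  · rw [hsum, hQ, Lagrange.eval_interpolate_at_node _ hinj (mem_range.2 hi)]
    have := hpos i
    field_simp
  · have hN0 := hpos (N - 1)
    have hi0 := hpos i
    have hA0 : 0 ≤ A := by
      have h := hA (N - 1) (by omega)
      exact (abs_nonneg _).trans (le_of_mul_le_mul_right h hN0)
    rw [hsum, abs_mul, abs_of_pos hi0]
    have hQle : |Q.eval (u i)| ≤ ∑ τ ∈ range N, A / u (N - 1) * (2 * (1 / 2) ^ (N - 1 - τ)) := by
      rw [hQ, Lagrange.interpolate_apply, eval_finsetSum]
      refine (abs_sum_le_sum_abs _ _).trans (sum_le_sum fun τ hτ => ?_)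
      rw [mem_range] at hτ
      rw [eval_mul, eval_C, abs_mul]
      refine mul_le_mul ?_ (abs_eval_lagrange_basis_le hpos hu hτ hi0.le (htail i hi))
        (abs_nonneg _) (by positivity)
      have := hpos τ
      rw [abs_div, abs_of_pos this, div_le_div_iff₀ this hN0]
      exact hA τ hτ
    have hgeo : ∑ τ ∈ range N, ((1 : ℝ) / 2) ^ (N - 1 - τ) ≤ 2 := by
      rw [sum_range_reflect (fun i => ((1 : ℝ) / 2) ^ i) N]
      exact sum_geometric_two_le N
    rw [← mul_sum, ← mul_sum] at hQle
    calc u i * |Q.eval (u i)| ≤ u i * (A / u (N - 1) * (2 * 2)) := by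
          gcongr
          refine hQle.trans ?_
          gcongr
      _ = _ := by ring

end Lacunary

/-! ### Approximation of decaying kernels by attention kernels. -/

section Kernels

/-- Interpolation of a sequence dominated by `K b`, with an error dominated by `5 K b` that
vanishes at the first `N` indices. -/
theorem exists_lacunary_approximation {u b : ℕ → ℝ} {N : ℕ} (hN : 1 ≤ N) (hpos : ∀ i, 0 < u i)
    (hu : ∀ i, i + 1 < N → 3 * u (i + 1) ≤ u i) (htail : ∀ i, N ≤ i → u i ≤ u (N - 1))
    (hub : ∀ i j, i ≤ j → u j * b i ≤ u i * b j) {K : ℝ} (hK : 0 ≤ K) {a : ℕ → ℝ}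
    (ha : ∀ i, |a i| ≤ K * b i) :
    ∃ α : Fin N → ℝ, ∀ i, |a i - ∑ h, α h * u i ^ (h.val + 1)| ≤
      if i < N then 0 else 5 * K * b i := by
  have hA : ∀ i < N, |a i| * u (N - 1) ≤ K * b (N - 1) * u i := by
    intro i hi
    calc |a i| * u (N - 1) ≤ K * b i * u (N - 1) :=
          mul_le_mul_of_nonneg_right (ha i) (hpos _).le
      _ = K * (u (N - 1) * b i) := by ring
      _ ≤ K * (u i * b (N - 1)) := mul_le_mul_of_nonneg_left (hub i (N - 1) (by omega)) hK
      _ = _ := by ring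
  obtain ⟨α, h₁, h₂⟩ := exists_lacunary_interpolation hN hpos hu htail a hA
  refine ⟨α, fun i => ?_⟩
  split_ifs with hi
  · rw [h₁ i hi, sub_self, abs_zero]
  · rw [not_lt] at hi
    -- Since `u` decays at least as fast as `b`, the interpolant is at most `4 K b i` past the
    -- nodes; the target adds one more `K b i`.
    have h₃ : b (N - 1) * (u i / u (N - 1)) ≤ b i := by
      rw [← mul_div_assoc, div_le_iff₀ (hpos _), mul_comm, mul_comm (b i)]
      exact hub _ _ (by omega)
    have h₄ := mul_le_mul_of_nonneg_left h₃ hK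
    have h₅ := abs_sub (a i) (∑ h, α h * u i ^ (h.val + 1))
    have h₆ := h₂ i hi
    have h₇ := ha i
    linarith

/-- The unnormalised attention weights `exp(p φ(s))` of a dot-product-free head. -/
noncomputable def headKernel (ty : RPEType) (p : ℝ) (s : ℕ) : ℝ :=
  (EReal.exp ((p : EReal) * rpePhi ty (s : ℤ))).toReal

theorem headKernel_lin (p : ℝ) (s : ℕ) : headKernel RPEType.lin p s = Real.exp (-(p * s)) := by
  rw [headKernel, rpePhi, if_pos (Int.natCast_nonneg s), ← EReal.coe_mul, EReal.exp_coe,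
    ENNReal.toReal_ofReal (Real.exp_pos _).le]
  simp

theorem headKernel_log_zero {p : ℝ} (hp : 0 < p) : headKernel RPEType.log p 0 = 0 := by
  rw [headKernel, rpePhi, if_neg (by norm_num), EReal.coe_mul_bot_of_pos hp]
  simp

theorem headKernel_log_succ (p : ℝ) (s : ℕ) :
    headKernel RPEType.log p (s + 1) = Real.exp (-(p * Real.log (s + 1))) := by
  rw [headKernel, rpePhi, if_pos (by push_cast; omega), ← EReal.coe_mul, EReal.exp_coe,
    ENNReal.toReal_ofReal (Real.exp_pos _).le]
  simp

theorem headKernel_nonneg (ty : RPEType) (p : ℝ) (s : ℕ) : 0 ≤ headKernel ty p s :=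
  ENNReal.toReal_nonneg

theorem exp_neg_mul_log_eq_rpow (p : ℝ) (s : ℕ) :
    Real.exp (-(p * Real.log (s + 1))) = ((s + 1 : ℕ) : ℝ) ^ (-p) := by
  rw [Real.rpow_def_of_pos (by positivity)]
  push_cast
  ring_nf

theorem summable_headKernel (ty : RPEType) {p : ℝ} (hp : 1 < p) : Summable (headKernel ty p) := by
  cases ty with
  | lin =>
    simp only [funext (headKernel_lin p)]
    have h : ∀ s : ℕ, Real.exp (-(p * s)) = Real.exp (-p) ^ s := fun s => by
      rw [← Real.exp_nat_mul]; ring_nf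
    simp only [h]
    exact summable_geometric_of_lt_one (Real.exp_pos _).le (Real.exp_lt_one_iff.mpr (by linarith))
  | log =>
    rw [← summable_nat_add_iff 1]
    simp only [headKernel_log_succ, exp_neg_mul_log_eq_rpow]
    exact (summable_nat_add_iff 1).2 (Real.summable_nat_rpow.2 (by linarith))

theorem tsum_headKernel_pos (ty : RPEType) {p : ℝ} (hp : 1 < p) :
    0 < ∑' s, headKernel ty p s := by
  refine (summable_headKernel ty hp).tsum_pos (headKernel_nonneg ty p) 1 ?_
  cases ty with
  | lin => rw [headKernel_lin]; exact Real.exp_pos _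
  | log => rw [show (1 : ℕ) = 0 + 1 from rfl, headKernel_log_succ]; exact Real.exp_pos _

/-- The kernels realised by a residual connection of strength `g` and attention heads with
coefficients `α` and exponents `p`. -/
noncomputable def attnKernel (ty : RPEType) {H : ℕ} (p : Fin H → ℝ) (g : ℝ) (α : Fin H → ℝ)
    (s : ℕ) : ℝ :=
  (if s = 0 then g else 0) + ∑ h, α h * headKernel ty (p h) s

theorem exp_mul_natCast_succ (x y : ℝ) (h : ℕ) :
    Real.exp (-(x * (h + 1) * y)) = Real.exp (-(x * y)) ^ (h + 1) := by
  rw [← Real.exp_nat_mul]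
  push_cast
  ring_nf

theorem exp_neg_le_factorial_div_pow {x : ℝ} (hx : 0 < x) (n : ℕ) :
    Real.exp (-x) ≤ n.factorial / x ^ n := by
  have h := Real.pow_div_factorial_le_exp x hx.le n
  rw [Real.exp_neg, inv_le_comm₀ (Real.exp_pos _) (by positivity), inv_div]
  exact h

theorem hasSum_tail {N : ℕ} {b : ℕ → ℝ} {S : ℝ} (hb : HasSum (fun j => b (j + N)) S) :
    HasSum (fun i => if i < N then 0 else b i) S := by
  rw [← hasSum_nat_add_iff' N, Finset.sum_eq_zero fun i hi => if_pos (Finset.mem_range.1 hi),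
    sub_zero]
  simpa using hb

/-- The rate is fixed at `n / 99`, the slowest compatible with `n ≤ ⌊99 β⌋`, so the constant depends
on `n` alone. The tail from `H` on is geometric, and `exp(-x) ≤ n! / x ^ n` turns it into a power of
`H`. -/
theorem exists_exponential_approximation {n : ℕ} (hn : 1 ≤ n) {H : ℕ} (hH : 1 ≤ H) :
    ∃ p : Fin H → ℝ, (∀ h, 1 < p h) ∧ ∀ (K : ℝ) (ρ : ℕ → ℝ),
      (∀ t : ℕ, |ρ t| ≤ K * Real.exp (-(n / 99 * t))) →
      ∃ g α, ∃ b : ℕ → ℝ, (∀ t, |ρ t - attnKernel RPEType.lin p g α t| ≤ b t) ∧ Summable b ∧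
        ∑' t, b t ≤ 5 * (n.factorial / (n / 99 : ℝ) ^ n * (1 - Real.exp (-(n / 99 : ℝ)))⁻¹) *
          K / H ^ n := by
  set β : ℝ := n / 99 with hβ
  have hβ0 : 0 < β := by have : (0 : ℝ) < n := by exact_mod_cast hn
                         positivity
  -- The summand `2` gives `exp c ≥ c + 1 ≥ 3`, hence lacunarity, while `c ≥ β` makes the nodes
  -- decay faster than the target.
  set c := β + 2 with hc
  refine ⟨fun h => c * (h + 1), fun h => by nlinarith [(Nat.cast_nonneg h.val : (0 : ℝ) ≤ h.val)],
    fun K ρ hρ => ?_⟩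
  have hK : 0 ≤ K := by simpa using (abs_nonneg _).trans (hρ 0)
  obtain ⟨α, hα⟩ := exists_lacunary_approximation (u := fun i => Real.exp (-(c * i)))
    (b := fun i => Real.exp (-(β * i))) hH (fun i => Real.exp_pos _) (fun i _ => by
      have h2 : (3 : ℝ) ≤ Real.exp c := by
        have := Real.add_one_le_exp c
        linarith
      have e : Real.exp (-(c * (i : ℝ))) = Real.exp c * Real.exp (-(c * ((i + 1 : ℕ) : ℝ))) := by
        rw [← Real.exp_add]; push_cast; ring_nf
      rw [e]
      exact mul_le_mul_of_nonneg_right h2 (Real.exp_pos _).le)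
    (fun i hi => Real.exp_le_exp.2 (neg_le_neg (mul_le_mul_of_nonneg_left
      (by exact_mod_cast (by omega)) (by positivity))))
    (fun i j hij => by
      rw [← Real.exp_add, ← Real.exp_add, Real.exp_le_exp]
      have : (i : ℝ) ≤ j := by exact_mod_cast hij
      rw [hc]
      nlinarith) hK hρ
  set y := Real.exp (-β) with hy
  have hy1 : y < 1 := Real.exp_lt_one_iff.mpr (by linarith)
  have hgeo := hasSum_geometric_of_lt_one (Real.exp_pos (-β)).le hy1
  have hsum : HasSum (fun i : ℕ => if i < H then (0 : ℝ) else 5 * K * Real.exp (-(β * i)))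
      (5 * K * (Real.exp (-(β * H)) * (1 - y)⁻¹)) := by
    refine hasSum_tail ?_
    have e : ∀ j : ℕ, 5 * K * Real.exp (-(β * (j + H : ℕ))) =
        5 * K * (Real.exp (-(β * H)) * Real.exp (-β) ^ j) := fun j => by
      rw [← Real.exp_nat_mul, ← Real.exp_add]
      push_cast
      ring_nf
    simp only [e]
    exact (hgeo.mul_left (Real.exp (-(β * H)))).mul_left (5 * K)
  refine ⟨0, α, _, fun t => ?_, hsum.summable, ?_⟩
  · convert hα t using 3
    simp only [attnKernel, headKernel_lin, exp_mul_natCast_succ, ite_self, zero_add]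
  · rw [hsum.tsum_eq]
    have hH' : (0 : ℝ) < H := by exact_mod_cast hH
    have h₁ := exp_neg_le_factorial_div_pow (mul_pos hβ0 hH') n
    have h₂ : 0 ≤ (1 - y)⁻¹ := inv_nonneg.2 (by linarith)
    calc _ ≤ 5 * K * (n.factorial / (β * H) ^ n * (1 - y)⁻¹) := by gcongr
      _ = _ := by rw [mul_pow]; field_simp

/-- The telescoping form of the integral comparison for the tail of a power series of exponent `n +
1`. -/
theorem inv_pow_succ_le_sub {n : ℕ} (hn : 1 ≤ n) {t : ℝ} (ht : 0 < t) :
    ((t + 1) ^ (n + 1))⁻¹ ≤ (t ^ n)⁻¹ - ((t + 1) ^ n)⁻¹ := by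
  have h : t ^ n * (t + 2) ≤ (t + 1) ^ (n + 1) := by
    induction n, hn using Nat.le_induction with
    | base => norm_num; nlinarith
    | succ n hn ih =>
      have h0 : 0 < t ^ n * (t + 2) := by positivity
      rw [pow_succ, pow_succ _ (n + 1)]
      nlinarith
  have h1 : 0 < t ^ n := by positivity
  have h2 : 0 < (t + 1) ^ n := by positivity
  rw [inv_sub_inv h1.ne' h2.ne', pow_succ, inv_eq_one_div, div_le_div_iff₀ (by positivity)
    (by positivity)]
  rw [pow_succ] at h
  nlinarith

theorem summable_tsum_inv_pow_le {n : ℕ} (hn : 1 ≤ n) {N : ℕ} (hN : 1 ≤ N) :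
    Summable (fun j : ℕ => (((j + N : ℕ) + 1 : ℝ) ^ (n + 1))⁻¹) ∧
      ∑' j : ℕ, (((j + N : ℕ) + 1 : ℝ) ^ (n + 1))⁻¹ ≤ ((N : ℝ) ^ n)⁻¹ := by
  have hN' : (0 : ℝ) < N := by exact_mod_cast hN
  have hpart : ∀ k : ℕ, ∑ j ∈ Finset.range k, (((j + N : ℕ) + 1 : ℝ) ^ (n + 1))⁻¹ ≤
      ((N : ℝ) ^ n)⁻¹ := by
    intro k
    suffices h : ∑ j ∈ Finset.range k, (((j + N : ℕ) + 1 : ℝ) ^ (n + 1))⁻¹ ≤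
        ((N : ℝ) ^ n)⁻¹ - (((k + N : ℕ) : ℝ) ^ n)⁻¹ by
      have : 0 ≤ (((k + N : ℕ) : ℝ) ^ n)⁻¹ := by positivity
      linarith
    induction k with
    | zero => simp
    | succ k ih =>
      rw [Finset.sum_range_succ]
      have h := inv_pow_succ_le_sub hn (t := ((k + N : ℕ) : ℝ)) (by positivity)
      have e : ((k + 1 + N : ℕ) : ℝ) = (k + N : ℕ) + 1 := by push_cast; ring
      rw [e]
      linarith
  have hnn : ∀ j : ℕ, 0 ≤ (((j + N : ℕ) + 1 : ℝ) ^ (n + 1))⁻¹ := fun j => by positivity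
  exact ⟨summable_of_sum_range_le hnn hpart, Real.tsum_le_of_sum_range_le hnn hpart⟩

theorem exp_neg_natCast_mul_log (q i : ℕ) :
    Real.exp (-((q : ℝ) * Real.log (i + 1))) = (((i : ℝ) + 1) ^ q)⁻¹ := by
  rw [Real.exp_neg, Real.exp_nat_mul, Real.exp_log (by positivity)]

theorem three_mul_le_pow_two_mul {N i : ℕ} (hi : i + 1 < N) :
    3 * ((i : ℝ) + 1) ^ (2 * N) ≤ ((i : ℝ) + 1 + 1) ^ (2 * N) := by
  have h0 : (0 : ℝ) < (i : ℝ) + 1 := by positivity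
  have h1 := one_add_mul_le_pow (a := ((i : ℝ) + 1)⁻¹) (by have := inv_pos.2 h0; linarith) (2 * N)
  have h2 : (3 : ℝ) ≤ (1 + ((i : ℝ) + 1)⁻¹) ^ (2 * N) := by
    refine le_trans ?_ h1
    have h3 : ((i : ℝ) + 1) ≤ N := by exact_mod_cast hi.le
    have h4 : 1 ≤ (N : ℝ) * ((i : ℝ) + 1)⁻¹ := by
      rw [← div_eq_mul_inv, le_div_iff₀ h0]; linarith
    push_cast
    linarith
  have e : ((i : ℝ) + 1 + 1) = (1 + ((i : ℝ) + 1)⁻¹) * (i + 1) := by field_simp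
  rw [e, mul_pow]
  exact mul_le_mul_of_nonneg_right h2 (by positivity)

/-- Logarithmic heads give weight zero to lag `0`, so the residual connection supplies `ρ 0` exactly
and interpolation concerns the lags `t = i + 1`. -/
theorem exists_power_approximation {n : ℕ} (hn : 1 ≤ n) {H : ℕ} (hH : 1 ≤ H) :
    ∃ p : Fin H → ℝ, (∀ h, 1 < p h) ∧ ∀ (K : ℝ) (ρ : ℕ → ℝ),
      (∀ t : ℕ, |ρ (t + 1)| ≤ K * (((t : ℝ) + 1) ^ (n + 1))⁻¹) →
      ∃ g α, ∃ b : ℕ → ℝ, (∀ t, |ρ t - attnKernel RPEType.log p g α t| ≤ b t) ∧ Summable b ∧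
        ∑' t, b t ≤ 5 * K / H ^ n := by
  -- Powers of consecutive integers are not lacunary for a fixed exponent. With `2 * H` added,
  -- Bernoulli's inequality yields the ratio `3` at the first `H` nodes; the part `n + 1` ensures
  -- faster decay than the target.
  set c : ℕ := n + 1 + 2 * H with hc
  have hp1 : ∀ h : Fin H, (1 : ℝ) < c * (h + 1) := fun h => by
    rw [hc]; exact_mod_cast (by nlinarith [h.val.zero_le])
  refine ⟨fun h => c * (h + 1), hp1, fun K ρ hρ => ?_⟩
  have hK : 0 ≤ K := by simpa using (abs_nonneg _).trans (hρ 0)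
  obtain ⟨α, hα⟩ := exists_lacunary_approximation (a := fun i => ρ (i + 1))
    (u := fun i => (((i : ℝ) + 1) ^ c)⁻¹)
    (b := fun i => (((i : ℝ) + 1) ^ (n + 1))⁻¹) hH (fun i => by positivity) (fun i hi => by
      rw [← div_eq_mul_inv, div_le_iff₀ (by positivity), inv_mul_eq_div, le_div_iff₀ (by positivity)]
      push_cast
      rw [hc, pow_add, pow_add _ (n + 1)]
      have h₁ := three_mul_le_pow_two_mul hi
      have h₂ : ((i : ℝ) + 1) ^ (n + 1) ≤ ((i : ℝ) + 1 + 1) ^ (n + 1) := by gcongr; linarith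
      calc _ = ((i : ℝ) + 1) ^ (n + 1) * (3 * ((i : ℝ) + 1) ^ (2 * H)) := by ring
        _ ≤ _ := mul_le_mul h₂ h₁ (by positivity) (by positivity))
    (fun i hi => by
      have : ((H - 1 : ℕ) : ℝ) ≤ i := by exact_mod_cast (by omega)
      gcongr)
    (fun i j hij => by
      have : (i : ℝ) ≤ j := by exact_mod_cast hij
      rw [← mul_inv, ← mul_inv]
      refine inv_anti₀ (by positivity) ?_
      rw [hc, pow_add, pow_add _ (n + 1)]
      have h : ((i : ℝ) + 1) ^ (2 * H) ≤ ((j : ℝ) + 1) ^ (2 * H) := by gcongr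
      calc _ = ((i : ℝ) + 1) ^ (n + 1) * ((j : ℝ) + 1) ^ (n + 1) * ((i : ℝ) + 1) ^ (2 * H) := by
            ring
        _ ≤ ((i : ℝ) + 1) ^ (n + 1) * ((j : ℝ) + 1) ^ (n + 1) * ((j : ℝ) + 1) ^ (2 * H) := by
            gcongr
        _ = _ := by ring) hK hρ
  obtain ⟨hs, hle⟩ := summable_tsum_inv_pow_le hn hH
  have hsum := hasSum_tail (b := fun i : ℕ => 5 * K * (((i : ℝ) + 1) ^ (n + 1))⁻¹) (N := H)
    (hs.hasSum.mul_left (5 * K))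
  set e : ℕ → ℝ := fun i => if i < H then 0 else 5 * K * (((i : ℝ) + 1) ^ (n + 1))⁻¹ with he
  let b : ℕ → ℝ := fun t => Nat.casesOn t 0 e
  have hb : HasSum b (5 * K * ∑' j : ℕ, (((j + H : ℕ) + 1 : ℝ) ^ (n + 1))⁻¹) := by
    rw [← hasSum_nat_add_iff' 1]
    simpa [b] using hsum
  refine ⟨ρ 0, α, b, fun t => ?_, hb.summable, ?_⟩
  · cases t with
    | zero =>
      have h0 : ∀ h : Fin H, headKernel RPEType.log (c * (h + 1)) 0 = 0 := fun h =>
        headKernel_log_zero (by linarith [hp1 h])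
      simp [attnKernel, b, h0]
    | succ t =>
      convert hα t using 3
      simp only [attnKernel, headKernel_log_succ, exp_mul_natCast_succ, exp_neg_natCast_mul_log,
        Nat.succ_ne_zero, if_false, zero_add]
  · rw [hb.tsum_eq, div_eq_mul_inv]
    exact mul_le_mul_of_nonneg_left hle (by positivity)

end Kernels

/-! ### Norm control for kernels, convolutions and memory vectors. -/

section MemoryKernels

theorem MemoryKernel.summable_abs (ρ : MemoryKernel) : Summable fun s => |ρ s| := by
  have h := (memℓp_gen_iff (p := 1) (by norm_num)).1 (lp.memℓp ρ)
  simpa using h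

theorem MemoryKernel.norm_eq_tsum (ρ : MemoryKernel) : ‖ρ‖ = ∑' s, |ρ s| := by
  rw [lp.norm_eq_tsum_rpow (by norm_num)]
  simp

/-- If `y` is longer than `x`, it is rescaled to the length of `x`; this moves it by `‖y‖ - ‖x‖ ≤ ‖x
- y‖`. Rescaling preserves the span of the attention kernels and keeps the memory vectors in the
domain of `f`. -/
theorem exists_smul_norm_le {E : Type*} [NormedAddCommGroup E] [NormedSpace ℝ E] (x y : E) :
    ∃ l : ℝ, ‖l • y‖ ≤ ‖x‖ ∧ ‖x - l • y‖ ≤ 2 * ‖x - y‖ := by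
  rcases le_or_gt ‖y‖ ‖x‖ with h | h
  · refine ⟨1, by simpa using h, ?_⟩
    rw [one_smul]
    linarith [norm_nonneg (x - y)]
  · have hy : 0 < ‖y‖ := (norm_nonneg x).trans_lt h
    have h0 : 0 ≤ ‖x‖ / ‖y‖ := by positivity
    refine ⟨‖x‖ / ‖y‖, ?_, ?_⟩
    · rw [norm_smul, Real.norm_eq_abs, abs_of_nonneg h0, div_mul_cancel₀ _ hy.ne']
    · have e : x - (‖x‖ / ‖y‖) • y = (x - y) + (1 - ‖x‖ / ‖y‖) • y := by module
      have h₁ : ‖(1 - ‖x‖ / ‖y‖) • y‖ = ‖y‖ - ‖x‖ := by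
        rw [norm_smul, Real.norm_eq_abs,
          abs_of_nonneg (sub_nonneg.2 ((div_le_one hy).2 h.le)), sub_mul, one_mul,
          div_mul_cancel₀ _ hy.ne']
      have h₂ := norm_sub_norm_le y x
      rw [norm_sub_rev] at h₂
      rw [e]
      refine (norm_add_le _ _).trans ?_
      rw [h₁]
      linarith

/-- An approximation by attention kernels can be made norm-nonincreasing at the cost of doubling
the error. -/
theorem exists_memoryKernel_approximation {ty : RPEType} {H : ℕ} {p : Fin H → ℝ}
    (ρ : MemoryKernel) {g : ℝ} {α : Fin H → ℝ} {b : ℕ → ℝ}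
    (hb : ∀ t, |ρ t - attnKernel ty p g α t| ≤ b t) (hs : Summable b) {ε : ℝ}
    (hε : ∑' t, b t ≤ ε) :
    ∃ (κ : MemoryKernel) (g' : ℝ) (α' : Fin H → ℝ), (∀ t, κ t = attnKernel ty p g' α' t) ∧
      ‖κ‖ ≤ ‖ρ‖ ∧ ‖ρ - κ‖ ≤ 2 * ε := by
  have hsum : Summable fun t => |ρ t - attnKernel ty p g α t| :=
    hs.of_nonneg_of_le (fun _ => abs_nonneg _) hb
  have hmem : Memℓp (fun t => ρ t - attnKernel ty p g α t) 1 :=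
    (memℓp_gen_iff (by norm_num)).2 (by simpa using hsum)
  let δ : MemoryKernel := ⟨fun t => ρ t - attnKernel ty p g α t, hmem⟩
  have hδ : ‖δ‖ ≤ ε := by
    rw [MemoryKernel.norm_eq_tsum]
    exact (hsum.tsum_le_tsum hb hs).trans hε
  obtain ⟨l, h₁, h₂⟩ := exists_smul_norm_le ρ (ρ - δ)
  refine ⟨l • (ρ - δ), l * g, fun h => l * α h, fun t => ?_, h₁, ?_⟩
  · change l * (ρ t - (ρ t - attnKernel ty p g α t)) = _
    rw [sub_sub_cancel, attnKernel, attnKernel, mul_add, Finset.mul_sum]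
    simp [mul_assoc]
  · rw [sub_sub_cancel] at h₂
    linarith

variable {d M : ℕ} {X : TokenSeq d}

theorem summable_smul_token (hX : X ∈ admissibleInputs d) {w : ℕ → ℝ}
    (hw : Summable fun s => |w s|) (t : ℤ) : Summable fun s : ℕ => w s • X (t - s) := by
  refine hw.of_norm_bounded fun s => ?_
  rw [norm_smul, Real.norm_eq_abs]
  exact mul_le_of_le_one_right (abs_nonneg _) (hX _)

theorem norm_seqConv_le (hX : X ∈ admissibleInputs d) (ρ : MemoryKernel) (t : ℤ) :
    ‖seqConv X ρ t‖ ≤ ‖ρ‖ := by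
  rw [MemoryKernel.norm_eq_tsum]
  refine tsum_of_norm_bounded ρ.summable_abs.hasSum fun s => ?_
  rw [norm_smul, Real.norm_eq_abs]
  exact mul_le_of_le_one_right (abs_nonneg _) (hX _)

theorem seqConv_sub (hX : X ∈ admissibleInputs d) (ρ κ : MemoryKernel) (t : ℤ) :
    seqConv X (ρ - κ) t = seqConv X ρ t - seqConv X κ t := by
  rw [seqConv, seqConv, seqConv, ← (summable_smul_token hX ρ.summable_abs t).tsum_sub
    (summable_smul_token hX κ.summable_abs t)]
  simp [sub_smul]

theorem norm_sq_eq_sum_blocks (v : EuclideanSpace ℝ (Fin M × Fin d)) :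
    ‖v‖ ^ 2 = ∑ k, ‖(WithLp.toLp 2 (fun i => v (k, i)) : Euc d)‖ ^ 2 := by
  simp only [EuclideanSpace.norm_sq_eq, Fintype.sum_prod_type]

theorem memoryVector_mem_memoryDomain (hX : X ∈ admissibleInputs d) {ρ κ : Fin M → MemoryKernel}
    (h : ∀ k, ‖κ k‖ ≤ ‖ρ k‖) (t : ℤ) : memoryVector κ X t ∈ memoryDomain d ρ :=
  fun k => (norm_seqConv_le hX (κ k) t).trans (h k)

theorem norm_sq_le_of_mem_memoryDomain {ρ : Fin M → MemoryKernel} {R : ℝ}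
    (hρ : ∀ k, ‖ρ k‖ ≤ R) {v : EuclideanSpace ℝ (Fin M × Fin d)} (hv : v ∈ memoryDomain d ρ) :
    ‖v‖ ^ 2 ≤ M * R ^ 2 := by
  rw [norm_sq_eq_sum_blocks]
  calc _ ≤ ∑ _k : Fin M, R ^ 2 := Finset.sum_le_sum fun k _ =>
        pow_le_pow_left₀ (norm_nonneg _) ((hv k).trans (hρ k)) 2
    _ = _ := by simp

theorem norm_memoryVector_sub_le (hX : X ∈ admissibleInputs d) {ρ κ : Fin M → MemoryKernel}
    {ε : ℝ} (h : ∀ k, ‖ρ k - κ k‖ ≤ ε) (t : ℤ) :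
    ‖memoryVector ρ X t - memoryVector κ X t‖ ≤ M * ε := by
  have h₁ : ‖memoryVector ρ X t - memoryVector κ X t‖ ≤ ∑ k, ‖seqConv X (ρ k - κ k) t‖ := by
    refine le_of_sq_le_sq ?_ (Finset.sum_nonneg fun _ _ => norm_nonneg _)
    rw [norm_sq_eq_sum_blocks]
    have e : ∀ k, (WithLp.toLp 2 (fun i => (memoryVector ρ X t - memoryVector κ X t) (k, i)) :
        Euc d) = seqConv X (ρ k - κ k) t := fun k => by
      rw [seqConv_sub hX]
      rfl
    simp only [e]
    exact Finset.sum_sq_le_sq_sum_of_nonneg fun _ _ => norm_nonneg _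
  calc _ ≤ _ := h₁
    _ ≤ ∑ _k : Fin M, ε := Finset.sum_le_sum fun k _ => (norm_seqConv_le hX _ t).trans (h k)
    _ = _ := by simp

end MemoryKernels

/-! ### Realization by dot-product-free Transformers. -/

section Realization

variable {d M H m : ℕ}

/-- The linear map `x ↦ (c₁ x, …, c_M x)`. -/
noncomputable def blockMap (d : ℕ) {M : ℕ} (c : Fin M → ℝ) :
    Euc d →L[ℝ] EuclideanSpace ℝ (Fin M × Fin d) :=
  LinearMap.toContinuousLinearMap
    { toFun := fun x => WithLp.toLp 2 fun q => c q.1 * x q.2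
      map_add' := fun x y => by ext; simp [mul_add]
      map_smul' := fun r x => by ext; simp [mul_left_comm] }

theorem blockMap_apply (c : Fin M → ℝ) (x : Euc d) (q : Fin M × Fin d) :
    blockMap d c x q = c q.1 * x q.2 := rfl

theorem OneLayerTransformer.DotProductFree.weight_eq {D : ℕ} {T : OneLayerTransformer d D H m}
    (hT : T.DotProductFree) (ty : RPEType) (X : TokenSeq d) (t : ℤ) (h : Fin H) :
    T.weight ty X t h = headKernel ty (T.p h) := by
  funext s
  simp [OneLayerTransformer.weight, headKernel, hT.1 h]

theorem seqConv_eq_of_attnKernel {ty : RPEType} {p : Fin H → ℝ} (hp : ∀ h, 1 < p h)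
    {X : TokenSeq d} (hX : X ∈ admissibleInputs d) {κ : MemoryKernel} {g : ℝ} {α : Fin H → ℝ}
    (hκ : ∀ t, κ t = attnKernel ty p g α t) (t : ℤ) :
    seqConv X κ t = g • X t + ∑ h, α h • ∑' s : ℕ, headKernel ty (p h) s • X (t - s) := by
  have hs : ∀ h, Summable fun s : ℕ => headKernel ty (p h) s • X (t - s) := fun h =>
    summable_smul_token hX (summable_headKernel ty (hp h)).abs t
  have h₁ : HasSum (fun s : ℕ => (if s = 0 then g else 0) • X (t - s)) (g • X t) := by
    convert hasSum_ite_eq (0 : ℕ) (g • X t) using 2 with s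
    split_ifs with h
    · simp [h]
    · simp
  have h₂ := hasSum_sum (s := Finset.univ) fun h _ => ((hs h).hasSum.const_smul (α h))
  rw [seqConv, ← (h₁.add h₂).tsum_eq]
  refine tsum_congr fun s => ?_
  rw [hκ, attnKernel, add_smul, Finset.sum_smul]
  simp only [mul_smul]

/-- Networks acting on convolutions with attention kernels are dot-product-free Transformers. -/
theorem exists_dpfTransformer (ty : RPEType) {p : Fin H → ℝ} (hp : ∀ h, 1 < p h)
    {κ : Fin M → MemoryKernel} {g : Fin M → ℝ} {α : Fin M → Fin H → ℝ}
    (hκ : ∀ k t, κ k t = attnKernel ty p (g k) (α k) t) (a : Fin m → ℝ)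
    (b : Fin m → EuclideanSpace ℝ (Fin M × Fin d)) (c : Fin m → ℝ) :
    ∃ F ∈ DPFTransformers d H m ty, ∀ X ∈ admissibleInputs d, ∀ t,
      F X t = ∑ k, a k * reluFn (inner ℝ (b k) (memoryVector κ X t) + c k) := by
  let V := Euc d × EuclideanSpace ℝ (Fin M × Fin d)
  let e : V ≃L[ℝ] Euc (Module.finrank ℝ V) := toEuclidean
  let Z : Fin H → ℝ := fun h => ∑' s, headKernel ty (p h) s
  have hZ : ∀ h, 0 < Z h := fun h => tsum_headKernel_pos ty (hp h)
  -- The readout map: the memories written by the heads, plus the current token with the residual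
  -- strengths `g`. It is absorbed into the inner weights of the network through its adjoint.
  let L : Euc (Module.finrank ℝ V) →L[ℝ] EuclideanSpace ℝ (Fin M × Fin d) :=
    ((blockMap d g).comp (ContinuousLinearMap.fst ℝ _ _) + ContinuousLinearMap.snd ℝ _ _).comp
      (e.symm : _ →L[ℝ] V)
  let T : OneLayerTransformer d (Module.finrank ℝ V) H m :=
    { WE := (e : V →L[ℝ] _).comp (ContinuousLinearMap.inl ℝ _ _)
      bE := 0
      WQ := 0
      WK := 0
      -- The factor `Z h` cancels the softmax denominator, which is a constant because the head is
      -- dot-product-free.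
      WV := fun h => (e : V →L[ℝ] _).comp ((ContinuousLinearMap.inr ℝ _ _).comp
        ((blockMap d fun k => Z h * α k h).comp ((ContinuousLinearMap.fst ℝ _ _).comp
          (e.symm : _ →L[ℝ] V))))
      WO := ContinuousLinearMap.id ℝ _
      p := p
      p_pos := fun h => one_pos.trans (hp h)
      a := a
      b := fun k => ContinuousLinearMap.adjoint L (b k)
      c := c }
  have hT : T.DotProductFree := ⟨fun _ => rfl, fun _ => rfl⟩
  refine ⟨T.output ty, ⟨_, T, hT, fun X _ t h => ?_, rfl⟩, fun X hX t => ?_⟩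
  · rw [hT.weight_eq]
    exact summable_headKernel ty (hp h)
  have hs : ∀ h, Summable fun s : ℕ => headKernel ty (p h) s • X (t - s) := fun h =>
    summable_smul_token hX (summable_headKernel ty (hp h)).abs t
  have hembed : ∀ t, T.embed X t = e (X t, 0) := fun t => by
    simp only [OneLayerTransformer.embed, T, add_zero]
    rfl
  have hhead : ∀ h, (∑' s : ℕ, (T.weight ty X t h s / ∑' j : ℕ, T.weight ty X t h j) •
      T.WV h (T.embed X (t - s))) = e (0, blockMap d (fun k => α k h)
        (∑' s : ℕ, headKernel ty (p h) s • X (t - s))) := by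
    intro h
    let A : Euc d →L[ℝ] Euc (Module.finrank ℝ V) := (e : V →L[ℝ] _).comp
      ((ContinuousLinearMap.inr ℝ _ _).comp (blockMap d fun k => α k h))
    have hA : e (0, blockMap d (fun k => α k h) (∑' s : ℕ, headKernel ty (p h) s • X (t - s))) =
        A (∑' s : ℕ, headKernel ty (p h) s • X (t - s)) := rfl
    rw [hA, A.map_tsum (hs h)]
    refine tsum_congr fun s => ?_
    have hblock : ∀ x : Euc d, blockMap d (fun k => Z h * α k h) x =
        Z h • blockMap d (fun k => α k h) x := fun x => by
      ext q
      simp [blockMap_apply, mul_assoc]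
    have hV : T.WV h (T.embed X (t - s)) = Z h • A (X (t - s)) := by
      rw [hembed, ← map_smul]
      simp only [T, A, ContinuousLinearMap.comp_apply, ContinuousLinearEquiv.coe_coe,
        ContinuousLinearEquiv.symm_apply_apply, ContinuousLinearMap.coe_fst', hblock, map_smul]
    rw [hV, smul_smul, hT.weight_eq, map_smul]
    congr 1
    exact div_mul_cancel₀ _ (hZ h).ne'
  have hhidden : L (T.hidden ty X t) = memoryVector κ X t := by
    have h₁ : T.hidden ty X t = e (X t, ∑ h, blockMap d (fun k => α k h)
        (∑' s : ℕ, headKernel ty (p h) s • X (t - s))) := by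
      rw [OneLayerTransformer.hidden, OneLayerTransformer.attn, hembed,
        Finset.sum_congr rfl fun h _ => hhead h]
      change e _ + ∑ h, ((e : V →L[ℝ] _).comp (ContinuousLinearMap.inr ℝ _ _)) _ = _
      rw [← map_sum]
      change e _ + e (0, _) = _
      rw [← map_add, Prod.mk_add_mk, add_zero, zero_add]
      rfl
    rw [h₁]
    ext q
    simp only [L, ContinuousLinearMap.comp_apply, ContinuousLinearEquiv.coe_coe,
      ContinuousLinearEquiv.symm_apply_apply, add_apply,
      ContinuousLinearMap.coe_fst', ContinuousLinearMap.coe_snd']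
    change _ = seqConv X (κ q.1) t q.2
    rw [seqConv_eq_of_attnKernel hp hX (hκ q.1)]
    simp [blockMap_apply]
  refine Finset.sum_congr rfl fun k _ => ?_
  change a k * reluFn (inner ℝ (ContinuousLinearMap.adjoint L (b k)) _ + c k) = _
  rw [ContinuousLinearMap.adjoint_inner_left, hhidden]

end Realization

/-! ### Combination of the two errors and bookkeeping of constants. -/

section Assembly

theorem exists_network_of_barronNorm {d M : ℕ} (hM : 0 < M) {R : ℝ} (hR : 1 ≤ R) {p : ℝ≥0∞}
    (hp : 1 ≤ p) {X : Set (EuclideanSpace ℝ (Fin M × Fin d))}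
    {f : EuclideanSpace ℝ (Fin M × Fin d) → ℝ} (hf : barronNorm p X f < ⊤) {m : ℕ} (hm : 1 ≤ m) :
    ∃ (a : Fin m → ℝ) (b : Fin m → EuclideanSpace ℝ (Fin M × Fin d)) (c : Fin m → ℝ),
      ∀ v ∈ X, ‖v‖ ^ 2 ≤ M * R ^ 2 → |f v - ∑ k, a k * reluFn (inner ℝ (b k) v + c k)| ≤
        20 * R * (barronNorm p X f).toReal * √(M * Real.log (m + 1) / m) := by
  have hM' : (1 : ℝ) ≤ M := by exact_mod_cast hM
  have hm' : (1 : ℝ) ≤ m := by exact_mod_cast hm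
  rcases eq_or_ne (barronNorm p X f) 0 with h0 | h0
  · refine ⟨0, 0, 0, fun v hv _ => ?_⟩
    rw [eq_zero_of_barronNorm_eq_zero hp h0 hv]
    simp [h0]
  have hB : 0 < (barronNorm p X f).toReal := ENNReal.toReal_pos h0 hf.ne
  have hlt : barronNorm p X f < ENNReal.ofReal (2 * (barronNorm p X f).toReal) := by
    rw [ENNReal.lt_ofReal_iff_toReal_lt hf.ne]
    linarith
  -- The radius accommodates the bias coordinate: `M R ^ 2 + 1 ≤ 2 M R ^ 2`. With twice the Barron
  -- norm, the sampling constant `5`, and `√2 ≤ 2 √(log (m + 1))`, the total constant is `20`.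
  obtain ⟨a, b, c, h⟩ := exists_network_of_barronNorm_lt hp hlt (r := R * √(2 * M))
    (by positivity) hm
  refine ⟨a, b, c, fun v hv hvR => (h v hv ?_).trans ?_⟩
  · rw [mul_pow, Real.sq_sqrt (by positivity)]
    have : 1 ≤ R ^ 2 := one_le_pow₀ hR
    nlinarith
  · have hlog : (1 : ℝ) / 2 ≤ Real.log (m + 1) := by
      have h₁ : Real.log 2 ≤ Real.log (m + 1) := Real.log_le_log (by norm_num) (by linarith)
      linarith [Real.log_two_gt_d9]
    have hs : √(2 * M) / √m ≤ 2 * √(M * Real.log (m + 1) / m) := by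
      rw [← Real.sqrt_div (by positivity)]
      apply Real.sqrt_le_iff.2
      refine ⟨by positivity, ?_⟩
      rw [mul_pow, Real.sq_sqrt (by positivity), ← mul_div_assoc]
      exact div_le_div_of_nonneg_right (by nlinarith) (by positivity)
    calc 2 * (barronNorm p X f).toReal * (5 * (R * √(2 * M)) / √m)
        = 10 * R * (barronNorm p X f).toReal * (√(2 * M) / √m) := by ring
      _ ≤ 10 * R * (barronNorm p X f).toReal * (2 * √(M * Real.log (m + 1) / m)) := by gcongr
      _ = _ := by ring

theorem exists_dpfTransformer_of_kernel_approximation {d M : ℕ} (hM : 0 < M)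
    {ρ : Fin M → MemoryKernel} {R : ℝ} (hR : 1 ≤ R) (hρ : ∀ k, ‖ρ k‖ ≤ R)
    {𝒟 : Set (EuclideanSpace ℝ (Fin M × Fin d))} (h𝒟 : memoryDomain d ρ ⊆ 𝒟)
    {f : EuclideanSpace ℝ (Fin M × Fin d) → ℝ} {p : ℝ≥0∞} (hp : 1 ≤ p)
    (hf : barronNorm p 𝒟 f < ⊤) {L : ℝ≥0} (hL : LipschitzOnWith L f 𝒟) {H m : ℕ} (hm : 1 ≤ m)
    (ty : RPEType) {q : Fin H → ℝ} (hq : ∀ h, 1 < q h) {ε : ℝ}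
    (happ : ∀ k, ∃ g α, ∃ b : ℕ → ℝ, (∀ t, |ρ k t - attnKernel ty q g α t| ≤ b t) ∧ Summable b ∧
      ∑' t, b t ≤ ε) :
    ∃ F ∈ DPFTransformers d H m ty,
      seqNorm (admissibleInputs d) (fun X t => essTarget f ρ X t - F X t) ≤
        ENNReal.ofReal (20 * R * (barronNorm p 𝒟 f).toReal * √(M * Real.log (m + 1) / m) +
          L * (M * (2 * ε))) := by
  have hκ : ∀ k, ∃ (κ : MemoryKernel) (g : ℝ) (α : Fin H → ℝ),
      (∀ t, κ t = attnKernel ty q g α t) ∧ ‖κ‖ ≤ ‖ρ k‖ ∧ ‖ρ k - κ‖ ≤ 2 * ε := fun k => by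
    obtain ⟨g, α, b, hb, hs, hε⟩ := happ k
    exact exists_memoryKernel_approximation (ρ k) hb hs hε
  choose κ g α hκ hκρ hκε using hκ
  obtain ⟨a, b, c, hnet⟩ := exists_network_of_barronNorm hM hR hp hf hm
  obtain ⟨F, hF, hFeq⟩ := exists_dpfTransformer ty hq hκ a b c
  refine ⟨F, hF, iSup_le fun t => iSup₂_le fun X hX => ?_⟩
  rw [Real.enorm_eq_ofReal_abs]
  apply ENNReal.ofReal_le_ofReal
  have hρD : memoryVector ρ X t ∈ memoryDomain d ρ :=
    memoryVector_mem_memoryDomain hX (fun _ => le_rfl) t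
  have hκD : memoryVector κ X t ∈ memoryDomain d ρ := memoryVector_mem_memoryDomain hX hκρ t
  have h₁ : |f (memoryVector ρ X t) - f (memoryVector κ X t)| ≤ L * (M * (2 * ε)) := by
    rw [← Real.dist_eq]
    refine (hL.dist_le_mul _ (h𝒟 hρD) _ (h𝒟 hκD)).trans ?_
    rw [dist_eq_norm]
    exact mul_le_mul_of_nonneg_left (norm_memoryVector_sub_le hX hκε t) L.2
  have h₂ := hnet _ (h𝒟 hκD) (norm_sq_le_of_mem_memoryDomain hρ hκD)
  dsimp only
  rw [hFeq X hX, essTarget]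
  refine (abs_sub_le _ (f (memoryVector κ X t)) _).trans ?_
  linarith

theorem le_errorBound {B R K L C C' : ℝ} (hK : 0 ≤ K) (hL : 0 ≤ L) (hC' : 0 ≤ C')
    (hC : 2 * C' ≤ C) {M : ℕ} (hM : 0 < M) (n H m : ℕ) :
    20 * R * B * √(M * Real.log (m + 1) / m) + L * (M * (2 * (C' * K / H ^ n))) ≤
      errorBound 20 C R K B L M n H m := by
  unfold errorBound
  have hM' : (1 : ℝ) ≤ M := by exact_mod_cast hM
  have hC0 : 0 ≤ C := le_trans (by positivity) hC
  have h : (M : ℝ) ≤ M ^ (n + 1) := le_self_pow₀ hM' (by omega)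
  gcongr
  calc (M : ℝ) * (2 * (C' * K / H ^ n)) = 2 * C' * K * M / H ^ n := by ring
    _ ≤ C * K * M ^ (n + 1) / H ^ n := by gcongr

end Assembly

theorem mainTheorem3 :
    ∃ (C₀ : ℝ) (C : ℕ → ℝ), 0 < C₀ ∧ (∀ n, 0 < C n) ∧
      -- the data shared by both parts
      ∀ (d M : ℕ) (_ : 0 < M) (ρ : Fin M → MemoryKernel)
        (R : ℝ) (_ : 1 ≤ R) (_ : ∀ k, ‖ρ k‖ ≤ R)
        (𝒟 : Set (EuclideanSpace ℝ (Fin M × Fin d))) (_ : memoryDomain d ρ ⊆ 𝒟)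
        (f : EuclideanSpace ℝ (Fin M × Fin d) → ℝ)
        (p : ℝ≥0∞) (_ : 1 ≤ p) (_ : barronNorm p 𝒟 f < ⊤)
        (L : ℝ≥0) (_ : LipschitzOnWith L f 𝒟)
        (β K : ℝ) (n H m : ℕ) (_ : 1 ≤ n) (_ : 1 ≤ H) (_ : 1 ≤ m),
        -- (A) exponentially decaying kernels, lin-RPE
        (0 < β → (∀ (k : Fin M) (t : ℕ), |ρ k t| ≤ K * Real.exp (-β * t)) →
          (n : ℤ) ≤ ⌊99 * β⌋ →
          ∃ F ∈ DPFTransformers d H m RPEType.lin,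
            seqNorm (admissibleInputs d) (fun X t => essTarget f ρ X t - F X t) ≤
              ENNReal.ofReal (errorBound C₀ (C n) R K (barronNorm p 𝒟 f).toReal L M n H m)) ∧
        -- (B) polynomially decaying kernels, log-RPE
        (1 < β → (∀ (k : Fin M) (t : ℕ), 1 ≤ t → |ρ k t| ≤ K * (t : ℝ) ^ (-β)) →
          (n : ℤ) ≤ ⌊(0.99 : ℝ) * β⌋ - 1 →
          ∃ F ∈ DPFTransformers d H m RPEType.log,
            seqNorm (admissibleInputs d) (fun X t => essTarget f ρ X t - F X t) ≤
              ENNReal.ofReal (errorBound C₀ (C n) R K (barronNorm p 𝒟 f).toReal L M n H m)) := by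
  let S : ℕ → ℝ := fun n =>
    n.factorial / (n / 99 : ℝ) ^ n * (1 - Real.exp (-(n / 99 : ℝ)))⁻¹
  have hS : ∀ n, 0 ≤ S n := fun n => by
    have h : Real.exp (-(n / 99 : ℝ)) ≤ 1 := Real.exp_le_one_iff.2 (neg_nonpos.2 (by positivity))
    have h' : 0 ≤ (1 - Real.exp (-(n / 99 : ℝ)))⁻¹ := inv_nonneg.2 (by linarith)
    positivity
  -- The factor `10` is `5` from interpolation times `2` from norm control; `S n` serves the
  -- exponential case and `1` the polynomial one.
  refine ⟨20, fun n => 10 * (S n + 1), by norm_num, fun n => by have := hS n; positivity, ?_⟩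
  intro d M hM ρ R hR hρR 𝒟 h𝒟 f p hp hf L hL β K n H m hn hH hm
  have hSn := hS n
  constructor
  · intro _ hρ hnβ
    have hβ : (n / 99 : ℝ) ≤ β := by
      have h := Int.le_floor.1 hnβ
      push_cast at h
      linarith
    have hK : 0 ≤ K := by simpa using (abs_nonneg _).trans (hρ ⟨0, hM⟩ 0)
    obtain ⟨q, hq, happ⟩ := exists_exponential_approximation hn hH
    obtain ⟨F, hF, hle⟩ := exists_dpfTransformer_of_kernel_approximation hM hR hρR h𝒟 hp hf hL hm
      RPEType.lin hq fun k => happ K (ρ k) fun t => (hρ k t).trans (by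
        refine mul_le_mul_of_nonneg_left (Real.exp_le_exp.2 ?_) hK
        rw [neg_mul, neg_le_neg_iff]
        exact mul_le_mul_of_nonneg_right hβ t.cast_nonneg)
    exact ⟨F, hF, hle.trans (ENNReal.ofReal_le_ofReal
      (le_errorBound (C' := 5 * S n) hK L.2 (by positivity) (by linarith) hM n H m))⟩
  · intro _ hρ hnβ
    have hβ : (n : ℝ) + 1 ≤ β := by
      have h := Int.le_floor.1 (show (n : ℤ) + 1 ≤ ⌊(0.99 : ℝ) * β⌋ by omega)
      push_cast at h
      have : (0 : ℝ) ≤ n := n.cast_nonneg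
      linarith
    have hK : 0 ≤ K := by simpa using (abs_nonneg _).trans (hρ ⟨0, hM⟩ 1 le_rfl)
    obtain ⟨q, hq, happ⟩ := exists_power_approximation hn hH
    obtain ⟨F, hF, hle⟩ := exists_dpfTransformer_of_kernel_approximation hM hR hρR h𝒟 hp hf hL hm
      RPEType.log hq fun k => happ K (ρ k) fun t => (hρ k (t + 1) (by omega)).trans (by
        refine mul_le_mul_of_nonneg_left ?_ hK
        rw [← Real.rpow_natCast, ← Real.rpow_neg (by positivity)]
        push_cast
        exact Real.rpow_le_rpow_of_exponent_le (by linarith [(t.cast_nonneg : (0 : ℝ) ≤ t)])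
          (neg_le_neg hβ))
    exact ⟨F, hF, hle.trans (ENNReal.ofReal_le_ofReal
      (le_errorBound (C' := 5) hK L.2 (by norm_num) (by linarith) hM n H m))⟩
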